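/- Let $\mathcal X,\mathcal S,\mathcal S_T,\mathcal S_R,\mathcal Y,\mathcal Z,\hat{\mathcal S}_T$ be finite alphabets, $P_{SS_TS_R}$ a probability mass function on $\mathcal S\times\mathcal S_T\times\mathcal S_R$, $P_{YZ|XS}$ a conditional probability mass function, and $d:\mathcal S_T\times\hat{\mathcal S}_T\to[0,\infty)$ a distortion function. In $n$ uses of the point-to-point ISAC channel the triples $(S_i,S_{T,i},S_{R,i})$ are i.i.d. with law $P_{SS_TS_R}$ (the sensing state $S_T$ and the receiver's state information $S_R$ may be correlated arbitrarily with the channel state $S$), and the channel is memoryless: given the past and $X_i=x$, $S_i=s$, $(S_{T,i},S_{R,i})$, the pair (output, feedback) $(Y_i,Z_i)$ has law $P_{YZ|XS}(\cdot\mid x,s)$. A $(2^{nR},n)$ code, $R\ge 0$, consists of the message set $\mathcal W=\{1,\dots,\lfloor 2^{nR}\rfloor\}$, encoding functions $x_i=f_i(w,z^{i-1})$ for $i=1,\dots,n$, a decoder $\hat w=h(y^n,s_R^n)\in\mathcal W$, and a state estimator $\hat s_T^n=\hat s_T^n(x^n,z^n)\in\hat{\mathcal S}_T^n$. The message $W$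 is uniform on $\mathcal W$ and independent of the states. A pair $(R,D)$ is achievable if there is a sequence of $(2^{nR},n)$ codes with $\lim_{n\to\infty}\Pr(\hat W\ne W)=0$ and $\limsup_{n\to\infty}\frac1n\sum_{i=1}^n\mathbb E[d(S_{T,i},\hat S_{T,i})]\le D$; the capacity-distortion function $C(D)$ is the supremum of the rates $R$ such that $(R,D)$ is achievable. **Theorem.** For $D\in\mathbb R$ let $\mathcal Q_X(D)$ be the set of the probability mass functions $P_X$ on $\mathcal X$ for which there is a conditional probability mass function $P_{\hat S_T|XZ}$ such that $\mathbb E[d(S_T,\hat S_T)]\le D$, where $(X,S,S_T,S_R,Y,Z,\hat S_T)$ has the law $$P_X(x)\,P_{SS_TS_R}(s,s_T,s_R)\,P_{YZ|XS}(y,z|x,s)\,P_{\hat S_T|XZ}(\hat s_T|x,z).$$ Then some pair $(R,D)$ is achievable if and only if $\mathcal Q_X(D)\neq\emptyset$. In that case $C(D)$ is finite, the maximum below is attained, and $$C(D)=\max_{P_X\in\mathcal Q_X(D)} I(X;Y|S_R),$$ with the mutual information in bits. -/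

import Mathlib

open Filter Topology

/-- Conditional mutual information `I(A;B|C)` in bits of a joint probability mass function
`p a b c` on finite alphabets,
`∑ p(a,b,c) log₂ (p(a,b,c) p(c) / (p(a,c) p(b,c)))`.
Terms with `p(a,b,c) = 0` vanish; if `p(a,b,c) > 0`, all the marginals are positive too. -/
noncomputable def condMutualInfo {A B C : Type*} [Fintype A] [Fintype B] [Fintype C]
    (p : A → B → C → ℝ) : ℝ :=
  ∑ a, ∑ b, ∑ c, p a b c *
    Real.logb 2 ((p a b c * ∑ a', ∑ b', p a' b' c) / ((∑ b', p a b' c) * ∑ a', p a' b c))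

/-- The data of a point-to-point ISAC channel over finite alphabets: the joint law of
(channel state, sensing state, receiver state information), the transition probabilities
`p(y,z|x,s)`, and the distortion function between sensing states and their estimates. -/
structure ISACModel (X S ST SR Y Z Shat : Type*) [Fintype X] [Fintype S] [Fintype ST]
    [Fintype SR] [Fintype Y] [Fintype Z] [Fintype Shat] where
  /-- `P_{S S_T S_R}` -/
  stateLaw : S × ST × SR → ℝ
  stateLaw_mem : stateLaw ∈ stdSimplex ℝ (S × ST × SR)
  /-- `channel x s (y, z) = P_{YZ|XS}(y,z|x,s)` -/
  channel : X → S → Y × Z → ℝ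
  channel_mem : ∀ x s, channel x s ∈ stdSimplex ℝ (Y × Z)
  /-- the distortion function `d` -/
  dist : ST → Shat → ℝ
  dist_nonneg : ∀ t u, 0 ≤ dist t u

/-- A code with message set of size `M` and block length `n`. -/
structure ISACCode (X SR Y Z Shat : Type*) (M n : ℕ) where
  /-- `x_i = f_i(w, z^{i-1})`: the `i`-th symbol depends on the message and on the feedback
  received strictly before time `i`. -/
  encoder : Fin M → (i : Fin n) → (Fin i → Z) → X
  /-- `ŵ = h(y^n, s_R^n)` -/
  decoder : (Fin n → Y) → (Fin n → SR) → Fin M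
  /-- the estimate of the sensing sequence from the codeword `x^n` and the feedback `z^n` -/
  estimator : (Fin n → X) → (Fin n → Z) → (Fin n → Shat)

namespace ISACCode

/-- The transmitted sequence `x^n` for the message `w` and the feedback sequence `z^n`. -/
def input {X SR Y Z Shat : Type*} {M n : ℕ} (c : ISACCode X SR Y Z Shat M n)
    (w : Fin M) (z : Fin n → Z) : Fin n → X :=
  fun i => c.encoder w i (fun j => z (Fin.castLE i.isLt.le j))

end ISACCode

namespace ISACModel

variable {X S ST SR Y Z Shat : Type*} [Fintype X] [Fintype S] [Fintype ST] [Fintype SR]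
  [Fintype Y] [Fintype Z] [Fintype Shat]

/-- The joint law of `(W, (S^n, S_T^n, S_R^n), (Y^n, Z^n))` when a code is used: the message is
uniform, the state triples are i.i.d. and independent of it, and the channel is memoryless. -/
noncomputable def blockLaw (m : ISACModel X S ST SR Y Z Shat) {M n : ℕ}
    (c : ISACCode X SR Y Z Shat M n)
    (w : Fin M) (s : Fin n → S × ST × SR) (yz : Fin n → Y × Z) : ℝ :=
  (1 / (M : ℝ)) *
    ∏ i, (m.stateLaw (s i) * m.channel (c.input w (fun j => (yz j).2) i) (s i).1 (yz i))

/-- `Pr(Ŵ ≠ W)` -/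
noncomputable def errorProb (m : ISACModel X S ST SR Y Z Shat) {M n : ℕ}
    (c : ISACCode X SR Y Z Shat M n) : ℝ :=
  ∑ w : Fin M, ∑ s : Fin n → S × ST × SR, ∑ yz : Fin n → Y × Z,
    m.blockLaw c w s yz *
      (if c.decoder (fun j => (yz j).1) (fun j => (s j).2.2) ≠ w then 1 else 0)

/-- `E[d(S_T^n, Ŝ_T^n)] = (1/n) ∑ E[d(S_{T,i}, Ŝ_{T,i})]` -/
noncomputable def blockDistortion (m : ISACModel X S ST SR Y Z Shat) {M n : ℕ}
    (c : ISACCode X SR Y Z Shat M n) : ℝ :=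
  (1 / (n : ℝ)) * ∑ i : Fin n,
    ∑ w : Fin M, ∑ s : Fin n → S × ST × SR, ∑ yz : Fin n → Y × Z,
      m.blockLaw c w s yz *
        m.dist (s i).2.1
          (c.estimator (c.input w (fun j => (yz j).2)) (fun j => (yz j).2) i)

/-- The pair `(R, D)` is achievable: there is a sequence of codes, the `n`-th one with block
length `n` and message set `{w : 1 ≤ w ≤ 2^{nR}}`, with vanishing error probability and
asymptotic distortion at most `D`. -/
def Achievable (m : ISACModel X S ST SR Y Z Shat) (R D : ℝ) : Prop :=
  0 ≤ R ∧ ∃ c : (n : ℕ) → ISACCode X SR Y Z Shat ⌊(2 : ℝ) ^ ((n : ℝ) * R)⌋₊ n,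
    Tendsto (fun n => m.errorProb (c n)) atTop (𝓝 0) ∧
      limsup (fun n => m.blockDistortion (c n)) atTop ≤ D

/-- The (operational) capacity-distortion function `C(D)`: the supremum of the rates `R`
such that `(R, D)` is achievable. -/
noncomputable def capacityDistortion (m : ISACModel X S ST SR Y Z Shat) (D : ℝ) : ℝ :=
  sSup {R | m.Achievable R D}

/-- The single-letter joint law
`P_X(x) P_{S S_T S_R}(s,t,r) P_{YZ|XS}(y,z|x,s) P_{Ŝ_T|XZ}(u|x,z)`. -/
def jointLaw (m : ISACModel X S ST SR Y Z Shat) (P : X → ℝ) (q : X → Z → Shat → ℝ)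
    (x : X) (s : S) (t : ST) (r : SR) (y : Y) (z : Z) (u : Shat) : ℝ :=
  P x * m.stateLaw (s, t, r) * m.channel x s (y, z) * q x z u

/-- `E[d(S_T, Ŝ_T)]` under the single-letter joint law. -/
def expectedDistortion (m : ISACModel X S ST SR Y Z Shat) (P : X → ℝ)
    (q : X → Z → Shat → ℝ) : ℝ :=
  ∑ x, ∑ s, ∑ t, ∑ r, ∑ y, ∑ z, ∑ u, m.jointLaw P q x s t r y z u * m.dist t u

/-- The set of input distributions that satisfy the sensing distortion constraint
`E[d(S_T, Ŝ_T)] ≤ D` for some state estimator `P_{Ŝ_T|XZ}`. -/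
def feasibleInputs (m : ISACModel X S ST SR Y Z Shat) (D : ℝ) : Set (X → ℝ) :=
  {P | P ∈ stdSimplex ℝ X ∧ ∃ q : X → Z → Shat → ℝ,
    (∀ x z, q x z ∈ stdSimplex ℝ Shat) ∧ m.expectedDistortion P q ≤ D}

/-- The single-letter law of `(X, Y, S_R)`, that is, the joint law with `S`, `S_T`, `Z` summed
out; the estimate `Ŝ_T` does not enter, as its conditional law sums to one. -/
def inputOutputLaw (m : ISACModel X S ST SR Y Z Shat) (P : X → ℝ) (x : X) (y : Y) (r : SR) : ℝ :=
  ∑ s, ∑ t, ∑ z, P x * m.stateLaw (s, t, r) * m.channel x s (y, z)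

/-- `I(X;Y|S_R)` for the input distribution `P`, in bits. -/
noncomputable def mutualInfo (m : ISACModel X S ST SR Y Z Shat) (P : X → ℝ) : ℝ :=
  condMutualInfo (m.inputOutputLaw P)

end ISACModel

/-!
The converse compares the law of message and letters under a code with the law obtained by dividing
the probability of each letter by the likelihood ratio `W(v|x) / q(v)`. Here `v = (y, s_R)` is the
decoder's observation, `W` the channel from `X` to `(Y, S_R)`, and `q` the output law of `W` for the
time-averaged input law `P` of the code. Under the second law the message and the observations are
independent, whatever the feedback, so the decoder is right with probability at most `1 / M`
(`sum_messageLaw_div_le`). The expected logarithm of the likelihood ratio is exactly `n I(P, W)`,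
since the letter at time `i` depends on the past only through the `i`-th input
(`sum_codeMean_letter`). With `log t ≤ t - 1` this gives
`(1 - ε) log M ≤ n I(P, W) + 1` (`one_sub_errorProb_mul_log_le`), without entropies and without the
concavity of the mutual information. Given the message and the feedback sequence, the sensing
states at different times are independent and each depends on the current input and feedback only;
hence block estimation is no better than the optimal symbolwise estimator, and `P` meets
the distortion constraint up to the distortion of the code
(`sum_averageInput_mul_sensingCost_le`). Compactness of the simplex and continuity of the mutual
information finish the converse (`Achievable.exists_mem_feasibleInputs`).

For achievability (`achievable_of_lt_mutualInfo`) the codewords are i.i.d., the feedback is used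
only for the symbolwise estimator, and the decoder tests whether `W^n(v|x) ≥ τ q^n(v)`. Its
error probability, averaged over the codebooks, is at most `M / τ` plus the probability that the
right codeword fails the test (`sum_codebookBound_le`), which a Chernoff bound makes exponentially
small (`missProb_prod_le`, `exists_exp_mul_infoMoment_lt_one`). The average distortion is at most
`D`, so some codebook does well in both respects (`exists_codebook`). Rate zero needs its own code
when the mutual information vanishes (`achievable_zero`).

Finally `I(X;Y|S_R) = I(X;Y,S_R)`, since `S_R` is independent of the input (`mutualInfo_eq`).
-/

/-! ### Sums of products over sequences -/

/-- Pushing a product law forward along a letterwise map `f` gives the product of the letterwise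
push-forwards. -/
theorem sum_prod_mul_comp {A V : Type*} [Fintype A] [Fintype V] [DecidableEq V] {n : ℕ}
    (k : Fin n → A → ℝ) (f : A → V) (φ : (Fin n → V) → ℝ) :
    ∑ a : Fin n → A, (∏ i, k i (a i)) * φ (fun i => f (a i)) =
      ∑ v : Fin n → V, (∏ i, ∑ a, if f a = v i then k i a else 0) * φ v := by
  have h1 : ∀ v : Fin n → V, (∏ i, ∑ a, if f a = v i then k i a else 0) * φ v =
      ∑ a : Fin n → A, if (fun i => f (a i)) = v then (∏ i, k i (a i)) * φ v else 0 := by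
    intro v
    rw [Fintype.prod_sum, Finset.sum_mul]
    refine Finset.sum_congr rfl fun a _ => ?_
    split_ifs with h
    · congr 1
      exact Finset.prod_congr rfl fun i _ => if_pos (congrFun h i)
    · obtain ⟨i, hi⟩ := Function.ne_iff.mp h
      rw [Finset.prod_eq_zero (Finset.mem_univ i) (if_neg hi), zero_mul]
  simp_rw [h1]
  rw [Finset.sum_comm]
  simp

/-- Under a product weight, a function of one coordinate only sees the weight of that
coordinate. -/
theorem sum_prod_mul_apply {ι A : Type*} [Fintype ι] [DecidableEq ι] [Fintype A]
    (k : ι → A → ℝ) (i₀ : ι) (f : A → ℝ) :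
    ∑ a : ι → A, (∏ i, k i (a i)) * f (a i₀) =
      (∏ i ∈ Finset.univ.erase i₀, ∑ b, k i b) * ∑ b, k i₀ b * f b := by
  have h : ∀ a : ι → A, (∏ i, k i (a i)) * f (a i₀) =
      ∏ i, k i (a i) * (if i = i₀ then f (a i) else 1) := by
    intro a
    rw [Finset.prod_mul_distrib, Finset.prod_ite_eq' Finset.univ i₀ (fun i => f (a i))]
    simp
  simp_rw [h]
  rw [← Fintype.prod_sum (fun i b => k i b * (if i = i₀ then f b else 1)),
    ← Finset.mul_prod_erase _ _ (Finset.mem_univ i₀), mul_comm]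
  congr 1
  · refine Finset.prod_congr rfl fun i hi => ?_
    simp [Finset.ne_of_mem_erase hi]
  · simp

/-- Distinct coordinates are independent under a product weight with probability factors. -/
theorem sum_prod_mul_apply_mul_apply {ι A : Type*} [Fintype ι] [DecidableEq ι] [Fintype A]
    (μ : A → ℝ) (hμ : ∑ b, μ b = 1) {i₀ i₁ : ι} (hne : i₁ ≠ i₀) (f g : A → ℝ) :
    ∑ a : ι → A, (∏ i, μ (a i)) * (f (a i₀) * g (a i₁)) =
      (∑ b, μ b * f b) * ∑ b, μ b * g b := by
  have h : ∀ a : ι → A, (∏ i, μ (a i)) * (f (a i₀) * g (a i₁)) =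
      (∏ i, μ (a i) * (if i = i₁ then g (a i) else 1)) * f (a i₀) := by
    intro a
    rw [Finset.prod_mul_distrib, Finset.prod_ite_eq' Finset.univ i₁ (fun i => g (a i))]
    simp only [Finset.mem_univ, if_true]
    ring
  simp_rw [h]
  rw [sum_prod_mul_apply (fun i b => μ b * (if i = i₁ then g b else 1)) i₀ f,
    ← Finset.mul_prod_erase _ _ (Finset.mem_erase.mpr ⟨hne, Finset.mem_univ i₁⟩),
    Finset.prod_eq_one]
  · simp [hne.symm, mul_comm]
  · intro i hi
    simp [Finset.ne_of_mem_erase hi, hμ]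

/-! ### Causal products -/

/-- The part of a sequence strictly before time `i`. -/
def seqPast {A : Type*} {n : ℕ} (a : Fin n → A) (i : Fin n) : Fin i → A :=
  fun j => a (Fin.castLE i.isLt.le j)

theorem seqPast_snoc_castSucc {A : Type*} {n : ℕ} (a : Fin n → A) (b : A) (i : Fin n) :
    seqPast (Fin.snoc a b : Fin (n + 1) → A) i.castSucc = seqPast a i := by
  funext j
  exact Fin.snoc_castSucc (α := fun _ => A) b a (Fin.castLE i.isLt.le j)

theorem seqPast_snoc_last {A : Type*} {n : ℕ} (a : Fin n → A) (b : A) :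
    seqPast (Fin.snoc a b : Fin (n + 1) → A) (Fin.last n) = a := by
  funext j
  exact Fin.snoc_castSucc (α := fun _ => A) b a j

theorem sum_eq_sum_snoc {A : Type*} [Fintype A] {n : ℕ} (F : (Fin (n + 1) → A) → ℝ) :
    ∑ a, F a = ∑ a : Fin n → A, ∑ b, F (Fin.snoc a b) := by
  rw [← (Fin.snocEquiv fun _ => A).sum_comp, Fintype.sum_prod_type, Finset.sum_comm]
  rfl

/-- The weight of a sequence whose `i`-th letter is drawn with the weight `k i p`, where `p` is
the past. -/
def causalProd {A : Type*} {n : ℕ} (k : (i : Fin n) → (Fin i → A) → A → ℝ) (a : Fin n → A) : ℝ :=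
  ∏ i, k i (seqPast a i) (a i)

theorem causalProd_snoc {A : Type*} {n : ℕ} (k : (i : Fin (n + 1)) → (Fin i → A) → A → ℝ)
    (a : Fin n → A) (b : A) :
    causalProd k (Fin.snoc a b) =
      causalProd (fun i : Fin n => k i.castSucc) a * k (Fin.last n) a b := by
  unfold causalProd
  rw [Fin.prod_univ_castSucc, seqPast_snoc_last]
  simp only [seqPast_snoc_castSucc, Fin.snoc_castSucc, Fin.snoc_last]

theorem causalProd_nonneg {A : Type*} {n : ℕ} {k : (i : Fin n) → (Fin i → A) → A → ℝ}
    (hk : ∀ i p a, 0 ≤ k i p a) (a : Fin n → A) : 0 ≤ causalProd k a :=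
  Finset.prod_nonneg fun i _ => hk i _ _

/-- If every step has total weight at most `B i`, whatever the past, then the sequences have total
weight at most the product of the `B i`. -/
theorem sum_causalProd_le {A : Type*} [Fintype A] {n : ℕ}
    (k : (i : Fin n) → (Fin i → A) → A → ℝ) (B : Fin n → ℝ) (hk : ∀ i p a, 0 ≤ k i p a)
    (hB0 : ∀ i, 0 ≤ B i) (hB : ∀ i p, ∑ a, k i p a ≤ B i) :
    ∑ a, causalProd k a ≤ ∏ i, B i := by
  induction n with
  | zero => simp [causalProd]
  | succ n ih =>
    rw [sum_eq_sum_snoc, Fin.prod_univ_castSucc]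
    simp_rw [causalProd_snoc, ← Finset.mul_sum]
    calc ∑ a : Fin n → A, causalProd (fun i : Fin n => k i.castSucc) a *
            ∑ b, k (Fin.last n) a b
        ≤ ∑ a : Fin n → A, causalProd (fun i : Fin n => k i.castSucc) a * B (Fin.last n) :=
          Finset.sum_le_sum fun a _ => mul_le_mul_of_nonneg_left (hB (Fin.last n) a)
            (causalProd_nonneg (fun i => hk i.castSucc) a)
      _ ≤ (∏ i : Fin n, B i.castSucc) * B (Fin.last n) := by
          rw [← Finset.sum_mul]
          exact mul_le_mul_of_nonneg_right
            (ih (fun i => k i.castSucc) _ (fun i => hk i.castSucc) (fun i => hB0 i.castSucc)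
              (fun i => hB i.castSucc)) (hB0 _)

/-- If the steps are probability laws, the letter at time `i₀` may be averaged out given the
past. -/
theorem sum_causalProd_mul {A : Type*} [Fintype A] {n : ℕ}
    (k : (i : Fin n) → (Fin i → A) → A → ℝ) (hk : ∀ i p, ∑ a, k i p a = 1) (i₀ : Fin n)
    (φ : (Fin i₀ → A) → A → ℝ) :
    ∑ a, causalProd k a * φ (seqPast a i₀) (a i₀) =
      ∑ a, causalProd k a * ∑ b, k i₀ (seqPast a i₀) b * φ (seqPast a i₀) b := by
  induction n with
  | zero => exact i₀.elim0
  | succ n ih =>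
    rw [sum_eq_sum_snoc, sum_eq_sum_snoc]
    simp_rw [causalProd_snoc]
    induction i₀ using Fin.lastCases with
    | last =>
      simp_rw [seqPast_snoc_last, Fin.snoc_last]
      refine Finset.sum_congr rfl fun a _ => ?_
      rw [← Finset.sum_mul, ← Finset.mul_sum, hk (Fin.last n) a, mul_one, Finset.mul_sum]
      simp_rw [mul_assoc]
    | cast i =>
      have h := ih (fun i => k i.castSucc) (fun i => hk i.castSucc) i φ
      have key : ∀ (ψ : (Fin n → A) → ℝ) (a : Fin n → A),
          ∑ b, causalProd (fun i : Fin n => k i.castSucc) a * k (Fin.last n) a b * ψ a =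
            causalProd (fun i : Fin n => k i.castSucc) a * ψ a := by
        intro ψ a
        rw [← Finset.sum_mul, ← Finset.mul_sum, hk (Fin.last n) a, mul_one]
      simp_rw [seqPast_snoc_castSucc, Fin.snoc_castSucc]
      rw [Finset.sum_congr rfl fun a _ => key (fun a => φ (seqPast a i) (a i)) a,
        Finset.sum_congr rfl fun a _ => key (fun a => ∑ b, k i.castSucc (seqPast a i) b *
          φ (seqPast a i) b) a]
      exact h

theorem sum_causalProd {A : Type*} [Fintype A] {n : ℕ}
    (k : (i : Fin n) → (Fin i → A) → A → ℝ) (hk : ∀ i p, ∑ a, k i p a = 1) :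
    ∑ a, causalProd k a = 1 := by
  induction n with
  | zero => simp [causalProd]
  | succ n ih =>
    rw [sum_eq_sum_snoc]
    simp_rw [causalProd_snoc, ← Finset.mul_sum, hk (Fin.last n), mul_one]
    exact ih _ fun i => hk i.castSucc

/-! ### Mutual information of an input law and a channel -/

/-- The output law `v ↦ ∑ x, P x * W x v` of the channel `W` for the input law `P`. -/
def outputMix {X V : Type*} [Fintype X] (W : X → V → ℝ) (P : X → ℝ) (v : V) : ℝ :=
  ∑ x, P x * W x v

/-- The mutual information, in nats, between the input and the output of the channel `W` for the
input law `P`. -/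
noncomputable def channelInfo {X V : Type*} [Fintype X] [Fintype V] (W : X → V → ℝ)
    (P : X → ℝ) : ℝ :=
  ∑ x, ∑ v, P x * W x v * Real.log (W x v / outputMix W P v)

section channel

variable {X V : Type*} [Fintype X] [Fintype V] {W : X → V → ℝ} {P : X → ℝ}

theorem outputMix_nonneg (hW : ∀ x, W x ∈ stdSimplex ℝ V) (hP : P ∈ stdSimplex ℝ X) (v : V) :
    0 ≤ outputMix W P v :=
  Finset.sum_nonneg fun x _ => mul_nonneg (hP.1 x) ((hW x).1 v)

theorem sum_outputMix (hW : ∀ x, W x ∈ stdSimplex ℝ V) (hP : P ∈ stdSimplex ℝ X) :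
    ∑ v, outputMix W P v = 1 := by
  unfold outputMix
  rw [Finset.sum_comm]
  simp_rw [← Finset.mul_sum, (hW _).2, mul_one, hP.2]

theorem mul_le_outputMix (hW : ∀ x, W x ∈ stdSimplex ℝ V) (hP : P ∈ stdSimplex ℝ X) (x : X)
    (v : V) : P x * W x v ≤ outputMix W P v :=
  Finset.single_le_sum (f := fun x => P x * W x v)
    (fun x _ => mul_nonneg (hP.1 x) ((hW x).1 v)) (Finset.mem_univ x)

/-- Mutual information as output entropy minus conditional output entropy. -/
theorem channelInfo_eq (hW : ∀ x, W x ∈ stdSimplex ℝ V) (hP : P ∈ stdSimplex ℝ X) :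
    channelInfo W P = ∑ v, Real.negMulLog (outputMix W P v) -
      ∑ x, ∑ v, P x * Real.negMulLog (W x v) := by
  have h : ∀ x v, P x * W x v * Real.log (W x v / outputMix W P v) =
      -(P x * W x v * Real.log (outputMix W P v)) - P x * Real.negMulLog (W x v) := by
    intro x v
    by_cases h0 : P x * W x v = 0
    · rcases mul_eq_zero.mp h0 with h | h <;> simp [h]
    · have hq : outputMix W P v ≠ 0 := (lt_of_lt_of_le
        (lt_of_le_of_ne (mul_nonneg (hP.1 x) ((hW x).1 v)) (Ne.symm h0))
        (mul_le_outputMix hW hP x v)).ne'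
      rw [Real.log_div (right_ne_zero_of_mul h0) hq, Real.negMulLog]
      ring
  unfold channelInfo
  simp_rw [h, Finset.sum_sub_distrib]
  congr 1
  rw [Finset.sum_comm]
  refine Finset.sum_congr rfl fun v _ => ?_
  rw [Real.negMulLog, Finset.sum_neg_distrib, ← Finset.sum_mul, outputMix]
  ring

theorem continuousOn_channelInfo (hW : ∀ x, W x ∈ stdSimplex ℝ V) :
    ContinuousOn (channelInfo W) (stdSimplex ℝ X) := by
  refine ContinuousOn.congr (Continuous.continuousOn ?_) fun P hP => channelInfo_eq hW hP
  unfold outputMix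
  have := Real.continuous_negMulLog
  fun_prop

end channel

namespace ISACModel

variable {X S ST SR Y Z Shat : Type*} [Fintype X] [Fintype S] [Fintype ST] [Fintype SR]
  [Fintype Y] [Fintype Z] [Fintype Shat]

/-! ### The single-letter channel and the single-letter estimator -/

/-- The law of everything that happens in one channel use, given the input letter. -/
def letterLaw (m : ISACModel X S ST SR Y Z Shat) (x : X) (a : (S × ST × SR) × (Y × Z)) : ℝ :=
  m.stateLaw a.1 * m.channel x a.1.1 a.2

/-- What the decoder sees of one channel use: the output and the receiver state information. -/
def observed (a : (S × ST × SR) × (Y × Z)) : Y × SR := (a.2.1, a.1.2.2)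

/-- The channel from the input to the decoder's observation `(Y, S_R)`. -/
def receiverChannel (m : ISACModel X S ST SR Y Z Shat) (x : X) (v : Y × SR) : ℝ :=
  ∑ s, ∑ t, ∑ z, m.stateLaw (s, t, v.2) * m.channel x s (v.1, z)

/-- The contribution of the feedback letter `z` to the expected distortion when `x` is sent and
the state estimate is `u`. -/
def estimateCost (m : ISACModel X S ST SR Y Z Shat) (x : X) (z : Z) (u : Shat) : ℝ :=
  ∑ σ, ∑ y, m.stateLaw σ * m.channel x σ.1 (y, z) * m.dist σ.2.1 u

theorem exists_bestEstimate [Nonempty Shat] (m : ISACModel X S ST SR Y Z Shat) (x : X) (z : Z) :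
    ∃ u, ∀ u', m.estimateCost x z u ≤ m.estimateCost x z u' :=
  Finite.exists_min _

/-- A symbolwise estimator that is optimal for every input letter and every feedback letter. -/
noncomputable def bestEstimate [Nonempty Shat] (m : ISACModel X S ST SR Y Z Shat) (x : X)
    (z : Z) : Shat :=
  (m.exists_bestEstimate x z).choose

theorem estimateCost_bestEstimate_le [Nonempty Shat] (m : ISACModel X S ST SR Y Z Shat) (x : X)
    (z : Z) (u : Shat) : m.estimateCost x z (m.bestEstimate x z) ≤ m.estimateCost x z u :=
  (m.exists_bestEstimate x z).choose_spec u

/-- The least expected distortion when the letter `x` is sent. -/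
noncomputable def sensingCost [Nonempty Shat] (m : ISACModel X S ST SR Y Z Shat) (x : X) : ℝ :=
  ∑ z, m.estimateCost x z (m.bestEstimate x z)

theorem letterLaw_nonneg (m : ISACModel X S ST SR Y Z Shat) (x : X)
    (a : (S × ST × SR) × (Y × Z)) : 0 ≤ m.letterLaw x a :=
  mul_nonneg (m.stateLaw_mem.1 _) ((m.channel_mem _ _).1 _)

theorem sum_letterLaw (m : ISACModel X S ST SR Y Z Shat) (x : X) :
    ∑ a, m.letterLaw x a = 1 := by
  simp_rw [Fintype.sum_prod_type (f := m.letterLaw x), letterLaw, ← Finset.mul_sum,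
    (m.channel_mem _ _).2, mul_one, m.stateLaw_mem.2]

theorem sum_letterLaw_mul_observed (m : ISACModel X S ST SR Y Z Shat) (x : X)
    (φ : Y × SR → ℝ) :
    ∑ a, m.letterLaw x a * φ (observed a) = ∑ v, m.receiverChannel x v * φ v := by
  simp only [letterLaw, observed, receiverChannel, Fintype.sum_prod_type, Finset.sum_mul]
  simp_rw [Finset.sum_comm (s := Finset.univ (α := SR)) (t := Finset.univ (α := Y)),
    Finset.sum_comm (s := Finset.univ (α := ST)) (t := Finset.univ (α := Y)),
    Finset.sum_comm (s := Finset.univ (α := S)) (t := Finset.univ (α := Y)),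
    Finset.sum_comm (s := Finset.univ (α := ST)) (t := Finset.univ (α := SR)),
    Finset.sum_comm (s := Finset.univ (α := S)) (t := Finset.univ (α := SR))]

theorem sum_letterLaw_mul_dist (m : ISACModel X S ST SR Y Z Shat) (x : X) (f : Z → Shat) :
    ∑ a, m.letterLaw x a * m.dist a.1.2.1 (f a.2.2) = ∑ z, m.estimateCost x z (f z) := by
  simp only [letterLaw, estimateCost]
  rw [Fintype.sum_prod_type, Finset.sum_comm (s := Finset.univ (α := Z))]
  refine Finset.sum_congr rfl fun σ _ => ?_
  rw [Fintype.sum_prod_type, Finset.sum_comm]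

theorem sum_letterLaw_mul_dist_bestEstimate [Nonempty Shat] (m : ISACModel X S ST SR Y Z Shat)
    (x : X) :
    ∑ a, m.letterLaw x a * m.dist a.1.2.1 (m.bestEstimate x a.2.2) = m.sensingCost x :=
  m.sum_letterLaw_mul_dist x _

theorem sensingCost_nonneg [Nonempty Shat] (m : ISACModel X S ST SR Y Z Shat) (x : X) :
    0 ≤ m.sensingCost x := by
  rw [← sum_letterLaw_mul_dist_bestEstimate]
  exact Finset.sum_nonneg fun a _ => mul_nonneg (m.letterLaw_nonneg _ _) (m.dist_nonneg _ _)

theorem receiverChannel_mem (m : ISACModel X S ST SR Y Z Shat) (x : X) :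
    m.receiverChannel x ∈ stdSimplex ℝ (Y × SR) := by
  refine ⟨fun v => Finset.sum_nonneg fun s _ => Finset.sum_nonneg fun t _ =>
    Finset.sum_nonneg fun z _ => mul_nonneg (m.stateLaw_mem.1 _) ((m.channel_mem _ _).1 _), ?_⟩
  simpa [m.sum_letterLaw] using (m.sum_letterLaw_mul_observed x fun _ => 1).symm

theorem sum_letterLaw_fiber [DecidableEq (Y × SR)] (m : ISACModel X S ST SR Y Z Shat) (x : X)
    (v : Y × SR) :
    (∑ a, if observed a = v then m.letterLaw x a else 0) = m.receiverChannel x v := by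
  simpa using m.sum_letterLaw_mul_observed x fun v' => if v' = v then 1 else 0

theorem letterLaw_le_receiverChannel (m : ISACModel X S ST SR Y Z Shat) (x : X)
    (a : (S × ST × SR) × (Y × Z)) : m.letterLaw x a ≤ m.receiverChannel x (observed a) := by
  classical
  rw [← sum_letterLaw_fiber]
  refine le_of_eq_of_le ?_ (Finset.single_le_sum
    (f := fun b => if observed b = observed a then m.letterLaw x b else 0) (fun b _ => ?_)
    (Finset.mem_univ a))
  · simp
  · split_ifs
    exacts [m.letterLaw_nonneg _ _, le_rfl]

/-- Since `S_R` is independent of the input, `I(X;Y|S_R) = I(X;Y,S_R)`. -/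
theorem mutualInfo_eq (m : ISACModel X S ST SR Y Z Shat) {P : X → ℝ}
    (hP : P ∈ stdSimplex ℝ X) :
    m.mutualInfo P = channelInfo m.receiverChannel P / Real.log 2 := by
  have hio : ∀ x y r, m.inputOutputLaw P x y r = P x * m.receiverChannel x (y, r) := by
    intro x y r
    simp only [inputOutputLaw, receiverChannel, Finset.mul_sum, mul_assoc]
  -- The law of `S_R`, which is the marginal of the receiver channel for every input.
  have hπ : ∀ x r, ∑ y, m.receiverChannel x (y, r) = ∑ s, ∑ t, m.stateLaw (s, t, r) := by
    intro x r
    simp only [receiverChannel]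
    rw [Finset.sum_comm]
    refine Finset.sum_congr rfl fun s _ => ?_
    rw [Finset.sum_comm]
    refine Finset.sum_congr rfl fun t _ => ?_
    simp_rw [← Finset.mul_sum]
    rw [← Fintype.sum_prod_type (f := m.channel x s), (m.channel_mem x s).2, mul_one]
  unfold mutualInfo condMutualInfo channelInfo
  simp_rw [hio, Finset.sum_div, ← Finset.mul_sum, hπ, ← Finset.sum_mul, hP.2, one_mul]
  refine Finset.sum_congr rfl fun x _ => ?_
  rw [Fintype.sum_prod_type]
  refine Finset.sum_congr rfl fun y _ => Finset.sum_congr rfl fun r _ => ?_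
  by_cases h0 : P x * m.receiverChannel x (y, r) = 0
  · simp [h0]
  have hPx := left_ne_zero_of_mul h0
  have hr : ∑ s, ∑ t, m.stateLaw (s, t, r) ≠ 0 := by
    rw [← hπ x r]
    intro h
    rw [Finset.sum_eq_zero_iff_of_nonneg fun y _ => (m.receiverChannel_mem x).1 _] at h
    exact right_ne_zero_of_mul h0 (h y (Finset.mem_univ y))
  rw [Real.logb, ← mul_div_assoc]
  congr 3
  change _ = _ / (∑ x, P x * m.receiverChannel x (y, r))
  rw [mul_right_comm, mul_comm (P x) (∑ s, _), mul_assoc, mul_assoc, mul_div_mul_left _ _ hr,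
    mul_div_mul_left _ _ hPx]

theorem expectedDistortion_eq (m : ISACModel X S ST SR Y Z Shat) (P : X → ℝ)
    (q : X → Z → Shat → ℝ) :
    m.expectedDistortion P q = ∑ x, P x * ∑ z, ∑ u, q x z u * m.estimateCost x z u := by
  simp only [expectedDistortion, jointLaw, estimateCost, Fintype.sum_prod_type, Finset.mul_sum]
  simp_rw [Finset.sum_comm (s := Finset.univ (α := Y)) (t := Finset.univ (α := Z)),
    Finset.sum_comm (s := Finset.univ (α := Y)) (t := Finset.univ (α := Shat)),
    Finset.sum_comm (s := Finset.univ (α := SR)) (t := Finset.univ (α := Z)),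
    Finset.sum_comm (s := Finset.univ (α := SR)) (t := Finset.univ (α := Shat)),
    Finset.sum_comm (s := Finset.univ (α := ST)) (t := Finset.univ (α := Z)),
    Finset.sum_comm (s := Finset.univ (α := ST)) (t := Finset.univ (α := Shat)),
    Finset.sum_comm (s := Finset.univ (α := S)) (t := Finset.univ (α := Z)),
    Finset.sum_comm (s := Finset.univ (α := S)) (t := Finset.univ (α := Shat))]
  refine Finset.sum_congr rfl fun x _ => Finset.sum_congr rfl fun z _ =>
    Finset.sum_congr rfl fun u _ => Finset.sum_congr rfl fun s _ => Finset.sum_congr rfl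
    fun t _ => Finset.sum_congr rfl fun r _ => Finset.sum_congr rfl fun y _ => ?_
  ring

/-- The optimal symbolwise estimator decides whether an input law is feasible. -/
theorem mem_feasibleInputs_iff [Nonempty Shat] (m : ISACModel X S ST SR Y Z Shat) {D : ℝ}
    {P : X → ℝ} :
    P ∈ m.feasibleInputs D ↔ P ∈ stdSimplex ℝ X ∧ ∑ x, P x * m.sensingCost x ≤ D := by
  classical
  constructor
  · rintro ⟨hP, q, hq, hD⟩
    refine ⟨hP, le_trans ?_ hD⟩
    rw [expectedDistortion_eq]
    refine Finset.sum_le_sum fun x _ => mul_le_mul_of_nonneg_left ?_ (hP.1 x)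
    refine Finset.sum_le_sum fun z _ => ?_
    calc m.estimateCost x z (m.bestEstimate x z)
        = ∑ u, q x z u * m.estimateCost x z (m.bestEstimate x z) := by
          rw [← Finset.sum_mul, (hq x z).2, one_mul]
      _ ≤ ∑ u, q x z u * m.estimateCost x z u :=
          Finset.sum_le_sum fun u _ => mul_le_mul_of_nonneg_left
            (m.estimateCost_bestEstimate_le x z u) ((hq x z).1 u)
  · rintro ⟨hP, hD⟩
    refine ⟨hP, fun x z => Pi.single (m.bestEstimate x z) 1,
      fun x z => single_mem_stdSimplex ℝ _, ?_⟩
    rw [expectedDistortion_eq]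
    refine le_of_eq_of_le ?_ hD
    simp [sensingCost, Pi.single_apply]

end ISACModel

namespace ISACCode

/-- The encoder as a function of the past letters of the whole system. -/
def letterInput {X S ST SR Y Z Shat : Type*} {M n : ℕ} (c : ISACCode X SR Y Z Shat M n)
    (w : Fin M) (i : Fin n) (p : Fin i → (S × ST × SR) × (Y × Z)) : X :=
  c.encoder w i fun j => (p j).2.2

end ISACCode

namespace ISACModel

variable {X S ST SR Y Z Shat : Type*} [Fintype X] [Fintype S] [Fintype ST] [Fintype SR]
  [Fintype Y] [Fintype Z] [Fintype Shat]

/-! ### Expectations under a code -/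

/-- The feedback sequence. -/
def feedback {n : ℕ} (a : Fin n → (S × ST × SR) × (Y × Z)) : Fin n → Z := fun j => (a j).2.2

/-- The conditional law of the sequence of letters given the message `w`. -/
def messageLaw (m : ISACModel X S ST SR Y Z Shat) {M n : ℕ} (c : ISACCode X SR Y Z Shat M n)
    (w : Fin M) (a : Fin n → (S × ST × SR) × (Y × Z)) : ℝ :=
  causalProd (fun i p b => m.letterLaw (c.letterInput w i p) b) a

theorem messageLaw_eq (m : ISACModel X S ST SR Y Z Shat) {M n : ℕ}
    (c : ISACCode X SR Y Z Shat M n) (w : Fin M) (a : Fin n → (S × ST × SR) × (Y × Z)) :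
    m.messageLaw c w a = ∏ i, m.letterLaw (c.input w (feedback a) i) (a i) := rfl

/-- The expectation of a function of the message and the sequence of letters under a code. -/
noncomputable def codeMean (m : ISACModel X S ST SR Y Z Shat) {M n : ℕ}
    (c : ISACCode X SR Y Z Shat M n)
    (φ : Fin M → (Fin n → (S × ST × SR) × (Y × Z)) → ℝ) : ℝ :=
  (1 / (M : ℝ)) * ∑ w, ∑ a, m.messageLaw c w a * φ w a

theorem sum_blockLaw_mul (m : ISACModel X S ST SR Y Z Shat) {M n : ℕ}
    (c : ISACCode X SR Y Z Shat M n)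
    (φ : Fin M → (Fin n → S × ST × SR) → (Fin n → Y × Z) → ℝ) :
    ∑ w, ∑ s, ∑ yz, m.blockLaw c w s yz * φ w s yz =
      m.codeMean c fun w a => φ w (fun i => (a i).1) fun i => (a i).2 := by
  rw [codeMean, Finset.mul_sum]
  refine Finset.sum_congr rfl fun w _ => ?_
  rw [← Fintype.sum_prod_type' (f := fun s yz => m.blockLaw c w s yz * φ w s yz),
    ← (Equiv.arrowProdEquivProdArrow (Fin n) (fun _ => S × ST × SR) fun _ => Y × Z).sum_comp,
    Finset.mul_sum]
  exact Finset.sum_congr rfl fun a _ => mul_assoc _ _ _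

section code

variable (m : ISACModel X S ST SR Y Z Shat) {M n : ℕ} (c : ISACCode X SR Y Z Shat M n)

theorem messageLaw_nonneg (w : Fin M) (a : Fin n → (S × ST × SR) × (Y × Z)) :
    0 ≤ m.messageLaw c w a :=
  causalProd_nonneg (fun _ _ _ => m.letterLaw_nonneg _ _) a

theorem sum_messageLaw (w : Fin M) : ∑ a, m.messageLaw c w a = 1 :=
  sum_causalProd _ fun _ _ => m.sum_letterLaw _

theorem codeMean_le_codeMean {φ ψ : Fin M → (Fin n → (S × ST × SR) × (Y × Z)) → ℝ}
    (h : ∀ w a, m.messageLaw c w a * φ w a ≤ m.messageLaw c w a * ψ w a) :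
    m.codeMean c φ ≤ m.codeMean c ψ :=
  mul_le_mul_of_nonneg_left
    (Finset.sum_le_sum fun w _ => Finset.sum_le_sum fun a _ => h w a) (by positivity)

theorem codeMean_nonneg {φ : Fin M → (Fin n → (S × ST × SR) × (Y × Z)) → ℝ}
    (h : ∀ w a, 0 ≤ φ w a) : 0 ≤ m.codeMean c φ :=
  mul_nonneg (by positivity) (Finset.sum_nonneg fun w _ => Finset.sum_nonneg fun a _ =>
    mul_nonneg (m.messageLaw_nonneg c w a) (h w a))

theorem codeMean_const (hM : 0 < M) (r : ℝ) : m.codeMean c (fun _ _ => r) = r := by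
  have : (M : ℝ) ≠ 0 := by positivity
  simp_rw [codeMean, ← Finset.sum_mul, sum_messageLaw]
  simp [this]

theorem codeMean_sub (φ ψ : Fin M → (Fin n → (S × ST × SR) × (Y × Z)) → ℝ) :
    m.codeMean c (fun w a => φ w a - ψ w a) = m.codeMean c φ - m.codeMean c ψ := by
  simp_rw [codeMean, mul_sub, Finset.sum_sub_distrib, mul_sub]

theorem codeMean_mul_left (r : ℝ) (φ : Fin M → (Fin n → (S × ST × SR) × (Y × Z)) → ℝ) :
    m.codeMean c (fun w a => r * φ w a) = r * m.codeMean c φ := by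
  simp_rw [codeMean, mul_left_comm _ r, ← Finset.mul_sum]
  ring

theorem codeMean_sum {ι : Type*} (s : Finset ι)
    (φ : ι → Fin M → (Fin n → (S × ST × SR) × (Y × Z)) → ℝ) :
    m.codeMean c (fun w a => ∑ i ∈ s, φ i w a) = ∑ i ∈ s, m.codeMean c (φ i) := by
  simp_rw [codeMean, Finset.mul_sum]
  rw [Finset.sum_comm (s := s)]
  refine Finset.sum_congr rfl fun w _ => ?_
  rw [Finset.sum_comm]

/-- The letter at time `i` follows the law of the memoryless channel given the input at time
`i`: feedback does not change the single-letter behaviour. -/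
theorem codeMean_letter (i : Fin n) (φ : X → (S × ST × SR) × (Y × Z) → ℝ) :
    m.codeMean c (fun w a => φ (c.input w (feedback a) i) (a i)) =
      m.codeMean c fun w a => ∑ b, m.letterLaw (c.input w (feedback a) i) b *
        φ (c.input w (feedback a) i) b := by
  unfold codeMean
  congr 1
  refine Finset.sum_congr rfl fun w _ => ?_
  exact sum_causalProd_mul (fun i p b => m.letterLaw (c.letterInput w i p) b)
    (fun _ _ => m.sum_letterLaw _) i fun p b => φ (c.letterInput w i p) b

open Classical in
/-- The law of the input at a uniformly chosen time. -/
noncomputable def averageInput (x : X) : ℝ :=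
  (1 / (n : ℝ)) * ∑ i, m.codeMean c fun w a => if c.input w (feedback a) i = x then 1 else 0

theorem sum_codeMean_input (hn : 0 < n) (ψ : X → ℝ) :
    ∑ i, m.codeMean c (fun w a => ψ (c.input w (feedback a) i)) =
      n * ∑ x, m.averageInput c x * ψ x := by
  classical
  have hn' : (n : ℝ) ≠ 0 := by positivity
  have h : ∀ i, m.codeMean c (fun w a => ψ (c.input w (feedback a) i)) =
      ∑ x, ψ x * m.codeMean c fun w a => if c.input w (feedback a) i = x then 1 else 0 := by
    intro i
    simp_rw [← codeMean_mul_left, ← codeMean_sum]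
    simp
  simp_rw [h]
  rw [Finset.sum_comm, Finset.mul_sum]
  refine Finset.sum_congr rfl fun x _ => ?_
  rw [averageInput, ← Finset.mul_sum]
  field_simp

theorem sum_codeMean_letter (hn : 0 < n) (φ : X → (S × ST × SR) × (Y × Z) → ℝ) :
    ∑ i, m.codeMean c (fun w a => φ (c.input w (feedback a) i) (a i)) =
      n * ∑ x, m.averageInput c x * ∑ b, m.letterLaw x b * φ x b := by
  simp_rw [codeMean_letter]
  exact m.sum_codeMean_input c hn fun x => ∑ b, m.letterLaw x b * φ x b

theorem averageInput_mem (hM : 0 < M) (hn : 0 < n) : m.averageInput c ∈ stdSimplex ℝ X := by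
  have hn' : (n : ℝ) ≠ 0 := by positivity
  refine ⟨fun x => mul_nonneg (by positivity) (Finset.sum_nonneg fun i _ =>
    m.codeMean_nonneg c fun w a => ?_), ?_⟩
  · split_ifs <;> norm_num
  · have h := m.sum_codeMean_input c hn fun _ => 1
    simp_rw [m.codeMean_const c hM, mul_one] at h
    simpa [hn'] using h.symm

theorem averageInput_pos (hM : 0 < M) {w : Fin M} {a : Fin n → (S × ST × SR) × (Y × Z)}
    (h : m.messageLaw c w a ≠ 0) (i : Fin n) :
    0 < m.averageInput c (c.input w (feedback a) i) := by
  classical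
  have hn : (0 : ℝ) < n := by exact_mod_cast i.pos
  have h0 : ∀ w' a', 0 ≤ m.messageLaw c w' a' *
      (if c.input w' (feedback a') i = c.input w (feedback a) i then (1 : ℝ) else 0) :=
    fun w' a' => mul_nonneg (m.messageLaw_nonneg c _ _) (by split_ifs <;> norm_num)
  refine mul_pos (by positivity) (Finset.sum_pos' (fun j _ => m.codeMean_nonneg c fun w' a' => ?_)
    ⟨i, Finset.mem_univ i, mul_pos (by positivity) (Finset.sum_pos'
      (fun w' _ => Finset.sum_nonneg fun a' _ => ?_) ⟨w, Finset.mem_univ w,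
        Finset.sum_pos' (fun a' _ => ?_) ⟨a, Finset.mem_univ a, ?_⟩⟩)⟩)
  · split_ifs <;> norm_num
  · convert h0 w' a'
  · convert h0 w a'
  · simpa using lt_of_le_of_ne (m.messageLaw_nonneg c w a) h.symm

theorem errorProb_eq : m.errorProb c = m.codeMean c fun w a =>
    if c.decoder (fun j => (observed (a j)).1) (fun j => (observed (a j)).2) ≠ w
      then 1 else 0 :=
  m.sum_blockLaw_mul c fun w s yz =>
    if c.decoder (fun j => (yz j).1) (fun j => (s j).2.2) ≠ w then 1 else 0

theorem blockDistortion_eq : m.blockDistortion c = (1 / (n : ℝ)) * ∑ i, m.codeMean c fun w a =>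
    m.dist (a i).1.2.1 (c.estimator (c.input w (feedback a)) (feedback a) i) := by
  unfold blockDistortion
  congr 1
  exact Finset.sum_congr rfl fun i _ => m.sum_blockLaw_mul c fun w s yz =>
    m.dist (s i).2.1 (c.estimator (c.input w (fun j => (yz j).2)) (fun j => (yz j).2) i)

theorem blockDistortion_nonneg : 0 ≤ m.blockDistortion c := by
  rw [blockDistortion_eq]
  exact mul_nonneg (by positivity) (Finset.sum_nonneg fun i _ =>
    m.codeMean_nonneg c fun w a => m.dist_nonneg _ _)

/-! ### Block estimators are no better than symbolwise estimators -/

theorem sum_letterLaw_feedback_mul_dist [DecidableEq Z] (x : X) (z : Z) (u : Shat) :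
    ∑ b, (if b.2.2 = z then m.letterLaw x b else 0) * m.dist b.1.2.1 u =
      m.estimateCost x z u := by
  simp only [letterLaw, estimateCost]
  rw [Fintype.sum_prod_type]
  refine Finset.sum_congr rfl fun σ _ => ?_
  rw [Fintype.sum_prod_type]
  refine Finset.sum_congr rfl fun y _ => ?_
  simp

/-- For an estimate that depends on the feedback only: given the message and the feedback, the
letters at different times are independent, and the one at time `i` depends on the input and the
feedback at time `i` only. -/
theorem sum_messageLaw_mul_dist [DecidableEq Z] (w : Fin M) (i : Fin n)
    (f : (Fin n → Z) → Shat) :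
    ∑ a, m.messageLaw c w a * m.dist (a i).1.2.1 (f (feedback a)) =
      ∑ z : Fin n → Z, (∏ j ∈ Finset.univ.erase i,
        ∑ b, if b.2.2 = z j then m.letterLaw (c.input w z j) b else 0) *
          m.estimateCost (c.input w z i) (z i) (f z) := by
  have h : ∀ z : Fin n → Z, (∏ j ∈ Finset.univ.erase i,
        ∑ b, if b.2.2 = z j then m.letterLaw (c.input w z j) b else 0) *
          m.estimateCost (c.input w z i) (z i) (f z) =
      ∑ a, if feedback a = z then m.messageLaw c w a * m.dist (a i).1.2.1 (f z) else 0 := by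
    intro z
    rw [← sum_letterLaw_feedback_mul_dist, ← sum_prod_mul_apply
      (fun j (b : (S × ST × SR) × (Y × Z)) =>
        if b.2.2 = z j then m.letterLaw (c.input w z j) b else 0) i
      fun b => m.dist b.1.2.1 (f z)]
    refine Finset.sum_congr rfl fun a _ => ?_
    split_ifs with hz
    · subst hz
      rw [messageLaw_eq]
      congr 1
      exact Finset.prod_congr rfl fun j _ => if_pos rfl
    · obtain ⟨j, hj⟩ := Function.ne_iff.mp hz
      rw [Finset.prod_eq_zero (Finset.mem_univ j) (if_neg hj), zero_mul]
  simp_rw [h]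
  rw [Finset.sum_comm]
  simp

theorem sum_averageInput_mul_sensingCost_le [Nonempty Shat] (hn : 0 < n) :
    ∑ x, m.averageInput c x * m.sensingCost x ≤ m.blockDistortion c := by
  classical
  have hn' : (n : ℝ) ≠ 0 := by positivity
  have h := m.sum_codeMean_letter c hn fun x a => m.dist a.1.2.1 (m.bestEstimate x a.2.2)
  simp_rw [sum_letterLaw_mul_dist_bestEstimate] at h
  rw [blockDistortion_eq, ← mul_le_mul_iff_right₀ (show (0 : ℝ) < n by positivity), ← h,
    ← mul_assoc, mul_one_div_cancel hn', one_mul]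
  refine Finset.sum_le_sum fun i _ => mul_le_mul_of_nonneg_left
    (Finset.sum_le_sum fun w _ => ?_) (by positivity)
  have h1 := m.sum_messageLaw_mul_dist c w i fun z => m.bestEstimate (c.input w z i) (z i)
  have h2 := m.sum_messageLaw_mul_dist c w i fun z => c.estimator (c.input w z) z i
  refine (h1.trans_le ?_).trans h2.ge
  refine Finset.sum_le_sum fun z _ => mul_le_mul_of_nonneg_left
    (m.estimateCost_bestEstimate_le _ _ _) (Finset.prod_nonneg fun j _ =>
      Finset.sum_nonneg fun b _ => ?_)
  split_ifs
  exacts [m.letterLaw_nonneg _ _, le_rfl]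

/-! ### The converse for a single code -/

/-- If the channel is replaced by one whose observation has the law `q` at each time, whatever
the input, then the message and the observations become independent. The replacement divides
each letter probability by the likelihood ratio `W(v|x) / q(v)`, and may lose mass where
`W(v|x) = 0`. -/
theorem sum_messageLaw_div_le {q : Y × SR → ℝ} (hq : ∀ v, 0 ≤ q v) (w : Fin M)
    {G : (Fin n → Y × SR) → ℝ} (hG : ∀ v, 0 ≤ G v) :
    ∑ a, m.messageLaw c w a * (G (fun i => observed (a i)) /
        ∏ i, (m.receiverChannel (c.input w (feedback a) i) (observed (a i)) /
          q (observed (a i)))) ≤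
      ∑ v : Fin n → Y × SR, (∏ i, q (v i)) * G v := by
  classical
  let k : (v : Fin n → Y × SR) → (i : Fin n) → (Fin i → (S × ST × SR) × (Y × Z)) →
      (S × ST × SR) × (Y × Z) → ℝ := fun v i p b =>
    m.letterLaw (c.letterInput w i p) b * (if observed b = v i then
      q (v i) / m.receiverChannel (c.letterInput w i p) (v i) else 0)
  have hk : ∀ v, ∑ a, causalProd (k v) a ≤ ∏ i, q (v i) := by
    intro v
    refine sum_causalProd_le _ _ (fun i p b => mul_nonneg (m.letterLaw_nonneg _ _) ?_)
      (fun i => hq _) fun i p => ?_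
    · split_ifs
      exacts [div_nonneg (hq _) ((m.receiverChannel_mem _).1 _), le_rfl]
    · rw [m.sum_letterLaw_mul_observed (c.letterInput w i p) fun v' => if v' = v i then
        q (v i) / m.receiverChannel (c.letterInput w i p) (v i) else 0]
      simp only [mul_ite, mul_zero, Finset.sum_ite_eq', Finset.mem_univ, if_true]
      by_cases h : m.receiverChannel (c.letterInput w i p) (v i) = 0
      · simp [h, hq]
      · rw [mul_div_cancel₀ _ h]
  calc _ = ∑ a, ∑ v : Fin n → Y × SR, causalProd (k v) a * G v := by
        refine Finset.sum_congr rfl fun a _ => ?_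
        rw [Finset.sum_eq_single fun i => observed (a i)]
        · rw [messageLaw_eq, div_eq_mul_inv, mul_left_comm, mul_comm, ← Finset.prod_inv_distrib,
            ← Finset.prod_mul_distrib]
          congr 1
          refine Finset.prod_congr rfl fun i _ => ?_
          rw [inv_div]
          exact (congrArg _ (if_pos rfl)).symm
        · intro v _ hv
          obtain ⟨j, hj⟩ := Function.ne_iff.mp hv
          rw [causalProd, Finset.prod_eq_zero (Finset.mem_univ j), zero_mul]
          exact mul_eq_zero_of_right _ (if_neg hj.symm)
        · exact fun h => (h (Finset.mem_univ _)).elim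
    _ ≤ _ := by
        rw [Finset.sum_comm]
        simp_rw [← Finset.sum_mul]
        exact Finset.sum_le_sum fun v _ => mul_le_mul_of_nonneg_right (hk v) (hG v)

/-- Fano's inequality and the single-letter bound in one step. The law of the message and the
letters under the code is compared, through `log t ≤ t - 1`, with a law under which message and
observations are independent, and the decoder is right with probability `1 / M`. -/
theorem one_sub_errorProb_mul_log_le (hM : 0 < M) (hn : 0 < n) :
    (1 - m.errorProb c) * Real.log M ≤
      n * channelInfo m.receiverChannel (m.averageInput c) + 1 := by
  classical
  set P := m.averageInput c with hPdef
  have hP : P ∈ stdSimplex ℝ X := m.averageInput_mem c hM hn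
  have hM' : (0 : ℝ) < M := by exact_mod_cast hM
  set q := outputMix m.receiverChannel P with hqdef
  have hq0 : ∀ v, 0 ≤ q v := outputMix_nonneg m.receiverChannel_mem hP
  let dec : (Fin n → Y × SR) → Fin M := fun v => c.decoder (fun j => (v j).1) fun j => (v j).2
  let g : Fin M → (Fin n → Y × SR) → ℝ := fun w v => if dec v = w then (M : ℝ) else 1
  have hg : ∀ w v, 0 < g w v := by
    intro w v
    dsimp only [g]
    split_ifs
    exacts [hM', one_pos]
  let r : Fin M → (Fin n → (S × ST × SR) × (Y × Z)) → Fin n → ℝ := fun w a i =>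
    m.receiverChannel (c.input w (feedback a) i) (observed (a i)) / q (observed (a i))
  have hlog : m.codeMean c (fun w a => Real.log (g w fun i => observed (a i)) -
      ∑ i, Real.log (r w a i)) ≤
      m.codeMean c fun w a => g w (fun i => observed (a i)) / (∏ i, r w a i) - 1 := by
    refine m.codeMean_le_codeMean c fun w a => ?_
    by_cases h0 : m.messageLaw c w a = 0
    · simp [h0]
    have hr : ∀ i, 0 < r w a i := by
      intro i
      have hl : 0 < m.letterLaw (c.input w (feedback a) i) (a i) :=
        lt_of_le_of_ne (m.letterLaw_nonneg _ _) fun h => h0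
          (Finset.prod_eq_zero (Finset.mem_univ i) h.symm)
      have hW := hl.trans_le (m.letterLaw_le_receiverChannel _ _)
      exact div_pos hW ((mul_pos (m.averageInput_pos c hM h0 i) hW).trans_le
        (mul_le_outputMix m.receiverChannel_mem hP _ _))
    refine mul_le_mul_of_nonneg_left ?_ (m.messageLaw_nonneg c w a)
    rw [← Real.log_prod fun i _ => (hr i).ne',
      ← Real.log_div (hg _ _).ne' (Finset.prod_pos fun i _ => hr i).ne']
    exact Real.log_le_sub_one_of_pos (div_pos (hg _ _) (Finset.prod_pos fun i _ => hr i))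
  have hlogg : m.codeMean c (fun w a => Real.log (g w fun i => observed (a i))) =
      (1 - m.errorProb c) * Real.log M := by
    have h1 : 1 - m.errorProb c = m.codeMean c fun w a =>
        1 - if dec (fun i => observed (a i)) ≠ w then 1 else 0 := by
      rw [codeMean_sub, m.codeMean_const c hM, errorProb_eq]
    rw [h1, mul_comm, ← codeMean_mul_left]
    congr 1
    funext w a
    by_cases h : dec (fun i => observed (a i)) = w <;> simp [g, h]
  have hinfo : m.codeMean c (fun w a => ∑ i, Real.log (r w a i)) =
      n * channelInfo m.receiverChannel P := by
    rw [codeMean_sum, m.sum_codeMean_letter c hn fun x a =>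
      Real.log (m.receiverChannel x (observed a) / q (observed a))]
    congr 1
    refine Finset.sum_congr rfl fun x _ => ?_
    rw [m.sum_letterLaw_mul_observed x fun v => Real.log (m.receiverChannel x v / q v),
      Finset.mul_sum]
    simp_rw [mul_assoc]
    rfl
  have hqn : ∑ v : Fin n → Y × SR, ∏ i, q (v i) = 1 := by
    rw [← Fintype.prod_sum fun (_ : Fin n) v => q v]
    simp [hqdef, sum_outputMix m.receiverChannel_mem hP]
  have htwo : m.codeMean c (fun w a => g w (fun i => observed (a i)) / (∏ i, r w a i)) ≤ 2 := by
    calc _ ≤ (1 / (M : ℝ)) * ∑ w, ∑ v : Fin n → Y × SR, (∏ i, q (v i)) * g w v :=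
          mul_le_mul_of_nonneg_left (Finset.sum_le_sum fun w _ =>
            m.sum_messageLaw_div_le c hq0 w fun v => (hg w v).le) (by positivity)
      _ ≤ (1 / (M : ℝ)) * ∑ v : Fin n → Y × SR, (∏ i, q (v i)) * (M + M) := by
          refine mul_le_mul_of_nonneg_left ?_ (by positivity)
          rw [Finset.sum_comm]
          refine Finset.sum_le_sum fun v _ => ?_
          rw [← Finset.mul_sum]
          refine mul_le_mul_of_nonneg_left ?_ (Finset.prod_nonneg fun i _ => hq0 _)
          calc ∑ w, g w v ≤ ∑ w, ((if dec v = w then (M : ℝ) else 0) + 1) := by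
                refine Finset.sum_le_sum fun w _ => ?_
                dsimp only [g]
                split_ifs <;> linarith
            _ = M + M := by simp [Finset.sum_add_distrib]
      _ = 2 := by
          rw [← Finset.sum_mul, hqn]
          field_simp
          norm_num
  rw [codeMean_sub, codeMean_sub, codeMean_const _ _ hM, hlogg, hinfo] at hlog
  linarith

end code

/-! ### The converse -/

theorem blockDistortion_le (m : ISACModel X S ST SR Y Z Shat) {M n : ℕ}
    (c : ISACCode X SR Y Z Shat M n) (hM : 0 < M) :
    m.blockDistortion c ≤ ∑ t, ∑ u, m.dist t u := by
  have hd : ∀ t u, m.dist t u ≤ ∑ t, ∑ u, m.dist t u := fun t u =>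
    (Finset.single_le_sum (fun u _ => m.dist_nonneg t u) (Finset.mem_univ u)).trans
      (Finset.single_le_sum (f := fun t => ∑ u, m.dist t u)
        (fun t _ => Finset.sum_nonneg fun u _ => m.dist_nonneg t u) (Finset.mem_univ t))
  have hB : 0 ≤ ∑ t, ∑ u, m.dist t u :=
    Finset.sum_nonneg fun t _ => Finset.sum_nonneg fun u _ => m.dist_nonneg t u
  rw [blockDistortion_eq]
  calc _ ≤ (1 / (n : ℝ)) * ∑ _i : Fin n, ∑ t, ∑ u, m.dist t u := by
        refine mul_le_mul_of_nonneg_left (Finset.sum_le_sum fun i _ => ?_) (by positivity)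
        exact (m.codeMean_le_codeMean c fun w a => mul_le_mul_of_nonneg_left (hd _ _)
          (m.messageLaw_nonneg c w a)).trans_eq (m.codeMean_const c hM _)
    _ ≤ ∑ t, ∑ u, m.dist t u := by
        rw [Finset.sum_const, Finset.card_univ, Fintype.card_fin, nsmul_eq_mul, ← mul_assoc,
          one_div]
        exact mul_le_of_le_one_left hB inv_mul_le_one

theorem messageCount_pos {R : ℝ} (hR : 0 ≤ R) (n : ℕ) : 0 < ⌊(2 : ℝ) ^ ((n : ℝ) * R)⌋₊ :=
  Nat.floor_pos.mpr (Real.one_le_rpow one_le_two (by positivity))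

theorem le_log_messageCount {R : ℝ} (hR : 0 ≤ R) (n : ℕ) :
    (n * R - 1) * Real.log 2 ≤ Real.log ⌊(2 : ℝ) ^ ((n : ℝ) * R)⌋₊ := by
  have h1 : (1 : ℝ) ≤ ⌊(2 : ℝ) ^ ((n : ℝ) * R)⌋₊ := by exact_mod_cast messageCount_pos hR n
  have h2 := Nat.lt_floor_add_one ((2 : ℝ) ^ ((n : ℝ) * R))
  have h3 : (2 : ℝ) ^ ((n : ℝ) * R - 1) ≤ ⌊(2 : ℝ) ^ ((n : ℝ) * R)⌋₊ := by
    rw [Real.rpow_sub_one two_ne_zero, div_le_iff₀ two_pos]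
    linarith
  rw [← Real.log_rpow two_pos]
  exact Real.log_le_log (by positivity) h3

/-- A rate is achievable only if it is at most the mutual information of some feasible input
law, namely of a cluster point of the time-averaged input laws of the codes. -/
theorem Achievable.exists_mem_feasibleInputs [Nonempty Shat]
    {m : ISACModel X S ST SR Y Z Shat} {R D : ℝ} (h : m.Achievable R D) :
    ∃ P ∈ m.feasibleInputs D, R ≤ m.mutualInfo P := by
  obtain ⟨hR, c, herr, hdist⟩ := h
  have hM := fun n => messageCount_pos hR n
  obtain ⟨P, hP, φ, hφ, hlim⟩ := (isCompact_stdSimplex ℝ X).tendsto_subseq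
    (x := fun n => m.averageInput (c (n + 1)))
    (fun n => m.averageInput_mem (c (n + 1)) (hM _) n.succ_pos)
  have hφ' : Tendsto (fun k => φ k + 1) atTop atTop :=
    (tendsto_add_atTop_nat 1).comp hφ.tendsto_atTop
  refine ⟨P, m.mem_feasibleInputs_iff.mpr ⟨hP, ?_⟩, ?_⟩
  · refine le_of_forall_gt_imp_ge_of_dense fun D' hD' => ?_
    have hbdd : IsBoundedUnder (· ≤ ·) atTop fun n => m.blockDistortion (c n) :=
      isBoundedUnder_of ⟨_, fun n => m.blockDistortion_le (c n) (hM n)⟩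
    have hev := hφ'.eventually (eventually_lt_of_limsup_lt (hdist.trans_lt hD') hbdd)
    have hcont : Continuous fun P : X → ℝ => ∑ x, P x * m.sensingCost x := by fun_prop
    refine le_of_tendsto ((hcont.tendsto P).comp hlim) (hev.mono fun k hk => ?_)
    exact (m.sum_averageInput_mul_sensingCost_le (c (φ k + 1)) (Nat.succ_pos _)).trans hk.le
  · rw [m.mutualInfo_eq hP, le_div_iff₀ (Real.log_pos one_lt_two)]
    have hinfo : Tendsto (fun k => channelInfo m.receiverChannel
        (m.averageInput (c (φ k + 1)))) atTop (𝓝 (channelInfo m.receiverChannel P)) :=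
      (continuousOn_channelInfo m.receiverChannel_mem P hP).tendsto.comp
        (tendsto_nhdsWithin_iff.mpr ⟨hlim, .of_forall fun k =>
          m.averageInput_mem (c (φ k + 1)) (hM _) (Nat.succ_pos _)⟩)
    have hinv : Tendsto (fun k => ((φ k + 1 : ℕ) : ℝ)⁻¹) atTop (𝓝 0) :=
      tendsto_inv_atTop_nhds_zero_nat.comp hφ'
    have herr' := herr.comp hφ'
    have hl : Tendsto (fun k => (1 - m.errorProb (c (φ k + 1))) *
        ((R - ((φ k + 1 : ℕ) : ℝ)⁻¹) * Real.log 2)) atTop (𝓝 ((1 - 0) * ((R - 0) * Real.log 2))) :=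
      (herr'.const_sub 1).mul ((hinv.const_sub R).mul_const _)
    have hr := hinfo.add hinv
    rw [sub_zero, sub_zero, one_mul] at hl
    rw [add_zero] at hr
    refine le_of_tendsto_of_tendsto hl hr ?_
    filter_upwards [herr'.eventually (eventually_lt_nhds one_pos)] with k hk
    have hN : (0 : ℝ) < (φ k + 1 : ℕ) := by positivity
    have hfano := m.one_sub_errorProb_mul_log_le (c (φ k + 1)) (hM _) (Nat.succ_pos _)
    have hlog := mul_le_mul_of_nonneg_left (le_log_messageCount hR (φ k + 1))
      (sub_nonneg.mpr hk.le)
    rw [← mul_le_mul_iff_right₀ hN]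
    calc _ = (1 - m.errorProb (c (φ k + 1))) * ((((φ k + 1 : ℕ) : ℝ) * R - 1) * Real.log 2) := by
          field_simp
      _ ≤ _ := hlog.trans hfano
      _ = _ := by field_simp

end ISACModel

/-! ### Random coding -/

/-- Some point does at least as well as the average. -/
theorem exists_le_of_sum_stdSimplex_mul_le {ι : Type*} [Fintype ι] {μ : ι → ℝ}
    (hμ : μ ∈ stdSimplex ℝ ι) {f : ι → ℝ} {b : ℝ} (h : ∑ i, μ i * f i ≤ b) : ∃ i, f i ≤ b := by
  have : Nonempty ι := by
    by_contra hι
    rw [not_nonempty_iff] at hι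
    simpa using hμ.2
  obtain ⟨i₀, hi₀⟩ := Finite.exists_min f
  refine ⟨i₀, le_trans ?_ h⟩
  calc f i₀ = ∑ i, μ i * f i₀ := by rw [← Finset.sum_mul, hμ.2, one_mul]
    _ ≤ _ := Finset.sum_le_sum fun i _ => mul_le_mul_of_nonneg_left (hi₀ i) (hμ.1 i)

theorem prod_mem_stdSimplex {ι A : Type*} [Fintype ι] [DecidableEq ι] [Fintype A]
    {μ : ι → A → ℝ} (hμ : ∀ i, μ i ∈ stdSimplex ℝ A) :
    (fun a : ι → A => ∏ i, μ i (a i)) ∈ stdSimplex ℝ (ι → A) := by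
  refine ⟨fun a => Finset.prod_nonneg fun i _ => (hμ i).1 _, ?_⟩
  rw [← Fintype.prod_sum]
  exact Finset.prod_eq_one fun i _ => (hμ i).2

section oneShot

variable {X V : Type*} [Fintype X] [Fintype V] {W : X → V → ℝ} {P : X → ℝ}

open Classical in
/-- The probability that the likelihood ratio of input and output is below the threshold `τ`. -/
noncomputable def missProb (W : X → V → ℝ) (P : X → ℝ) (τ : ℝ) : ℝ :=
  ∑ x, P x * ∑ v, W x v * if W x v < τ * outputMix W P v then 1 else 0

open Classical in
/-- The bound on the error probability of a threshold decoder for the codebook `C`: the right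
codeword fails the threshold test, or a wrong one passes it. -/
noncomputable def codebookBound {M : ℕ} (W : X → V → ℝ) (P : X → ℝ) (τ : ℝ)
    (C : Fin M → X) : ℝ :=
  (1 / (M : ℝ)) * ∑ w, ((∑ v, W (C w) v * if W (C w) v < τ * outputMix W P v then 1 else 0) +
    ∑ w' ∈ Finset.univ.erase w, ∑ v, W (C w) v *
      if τ * outputMix W P v ≤ W (C w') v then 1 else 0)

open Classical in
/-- The threshold decoder: any message whose codeword passes the test is a valid output. -/
theorem exists_decoder {M : ℕ} (hM : 0 < M) (hW : ∀ x, W x ∈ stdSimplex ℝ V) (P : X → ℝ)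
    (τ : ℝ) (C : Fin M → X) :
    ∃ h : V → Fin M, (1 / (M : ℝ)) * ∑ w, ∑ v, W (C w) v * (if h v ≠ w then 1 else 0) ≤
      codebookBound W P τ C := by
  have hex : ∀ v, ∃ w, (∃ w', τ * outputMix W P v ≤ W (C w') v) →
      τ * outputMix W P v ≤ W (C w) v := fun v => by
    by_cases h : ∃ w', τ * outputMix W P v ≤ W (C w') v
    · exact ⟨h.choose, fun _ => h.choose_spec⟩
    · exact ⟨⟨0, hM⟩, fun h' => (h h').elim⟩
  choose h hh using hex
  refine ⟨h, mul_le_mul_of_nonneg_left (Finset.sum_le_sum fun w _ => ?_) (by positivity)⟩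
  rw [Finset.sum_comm (s := Finset.univ.erase w), ← Finset.sum_add_distrib]
  refine Finset.sum_le_sum fun v _ => ?_
  rw [← Finset.mul_sum, ← mul_add]
  refine mul_le_mul_of_nonneg_left ?_ ((hW _).1 v)
  have h0 : ∀ w' ∈ Finset.univ.erase w,
      (0 : ℝ) ≤ if τ * outputMix W P v ≤ W (C w') v then 1 else 0 := fun w' _ => by
    split_ifs <;> norm_num
  have hs := Finset.sum_nonneg h0
  by_cases hw : W (C w) v < τ * outputMix W P v
  · rw [if_pos hw]
    split_ifs <;> linarith
  rw [if_neg hw, zero_add]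
  split_ifs with hne
  · refine le_of_eq_of_le ?_ (Finset.single_le_sum h0
      (Finset.mem_erase.mpr ⟨hne, Finset.mem_univ _⟩))
    rw [if_pos (hh v ⟨w, not_lt.mp hw⟩)]
  · exact hs

/-- A codeword that is independent of the output passes the threshold test with probability at
most `1 / τ`. -/
theorem sum_codebook_pass_le (hW : ∀ x, W x ∈ stdSimplex ℝ V)
    (hP : P ∈ stdSimplex ℝ X) {τ : ℝ} (hτ : 0 < τ) :
    ∑ v, (∑ x, P x * W x v) *
      ∑ x, P x * (open Classical in if τ * outputMix W P v ≤ W x v then 1 else 0) ≤ 1 / τ := by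
  calc _ ≤ ∑ v, outputMix W P v / τ := by
        refine Finset.sum_le_sum fun v _ => ?_
        change outputMix W P v * _ ≤ _
        rw [Finset.mul_sum, outputMix, Finset.sum_div]
        refine Finset.sum_le_sum fun x _ => ?_
        change outputMix W P v * _ ≤ _
        rw [mul_left_comm, mul_div_assoc]
        refine mul_le_mul_of_nonneg_left ?_ (hP.1 x)
        split_ifs with h
        · rw [le_div_iff₀ hτ, mul_one, mul_comm]
          exact h
        · simpa using div_nonneg ((hW x).1 v) hτ.le
    _ = 1 / τ := by rw [← Finset.sum_div, sum_outputMix hW hP]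

theorem sum_codebookBound_le {M : ℕ} (hM : 0 < M) (hW : ∀ x, W x ∈ stdSimplex ℝ V)
    (hP : P ∈ stdSimplex ℝ X) {τ : ℝ} (hτ : 0 < τ) :
    ∑ C : Fin M → X, (∏ w, P (C w)) * codebookBound W P τ C ≤ missProb W P τ + M / τ := by
  classical
  have hM' : (M : ℝ) ≠ 0 := by positivity
  simp_rw [codebookBound, mul_left_comm _ (1 / (M : ℝ)), ← Finset.mul_sum (a := 1 / (M : ℝ))]
  have hw : ∀ w : Fin M, ∑ C : Fin M → X, (∏ w, P (C w)) *
      ((∑ v, W (C w) v * if W (C w) v < τ * outputMix W P v then 1 else 0) +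
        ∑ w' ∈ Finset.univ.erase w, ∑ v, W (C w) v *
          if τ * outputMix W P v ≤ W (C w') v then 1 else 0) ≤
      missProb W P τ + M / τ := by
    intro w
    simp_rw [mul_add, Finset.sum_add_distrib]
    refine add_le_add (le_of_eq ?_) ?_
    · rw [sum_prod_mul_apply (fun _ => P) w fun x =>
        ∑ v, W x v * if W x v < τ * outputMix W P v then 1 else 0]
      simp [hP.2, missProb]
    · simp_rw [Finset.mul_sum]
      rw [Finset.sum_comm]
      calc _ ≤ ∑ w' ∈ Finset.univ.erase w, 1 / τ := by
            refine Finset.sum_le_sum fun w' hw' => ?_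
            rw [Finset.sum_comm]
            refine le_of_eq_of_le (Finset.sum_congr rfl fun v _ => ?_)
              (sum_codebook_pass_le hW hP hτ)
            exact sum_prod_mul_apply_mul_apply P hP.2 (Finset.ne_of_mem_erase hw')
              (fun x => W x v) fun x => if τ * outputMix W P v ≤ W x v then 1 else 0
        _ ≤ M / τ := by
            rw [Finset.sum_const, nsmul_eq_mul, mul_one_div]
            refine div_le_div_of_nonneg_right ?_ hτ.le
            exact_mod_cast (Finset.card_le_univ _).trans_eq (Fintype.card_fin M)
  calc _ = (1 / (M : ℝ)) * ∑ w : Fin M, ∑ C : Fin M → X, (∏ w, P (C w)) *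
      ((∑ v, W (C w) v * if W (C w) v < τ * outputMix W P v then 1 else 0) +
        ∑ w' ∈ Finset.univ.erase w, ∑ v, W (C w) v *
          if τ * outputMix W P v ≤ W (C w') v then 1 else 0) := by
        congr 1
        rw [Finset.sum_comm]
        simp_rw [Finset.mul_sum]
    _ ≤ (1 / (M : ℝ)) * ∑ _w : Fin M, (missProb W P τ + M / τ) :=
        mul_le_mul_of_nonneg_left (Finset.sum_le_sum fun w _ => hw w) (by positivity)
    _ = _ := by
        rw [Finset.sum_const, Finset.card_univ, Fintype.card_fin, nsmul_eq_mul, ← mul_assoc,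
          one_div_mul_cancel hM', one_mul]

open Classical in
/-- One-shot achievability with an input cost: averaging `√β * cost + error` over i.i.d.
codebooks gives a codebook for which both terms are under control. -/
theorem exists_codebook {M : ℕ} (hM : 0 < M) (hW : ∀ x, W x ∈ stdSimplex ℝ V)
    (hP : P ∈ stdSimplex ℝ X) {τ : ℝ} (hτ : 0 < τ) {cost : X → ℝ} (hcost : ∀ x, 0 ≤ cost x)
    {D β : ℝ} (hD : ∑ x, P x * cost x ≤ D) (hβ : missProb W P τ + M / τ ≤ β) (hβ0 : 0 < β) :
    ∃ (C : Fin M → X) (h : V → Fin M),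
      (1 / (M : ℝ)) * ∑ w, cost (C w) ≤ D + √β ∧
      (1 / (M : ℝ)) * ∑ w, ∑ v, W (C w) v * (if h v ≠ w then 1 else 0) ≤ √β * D + β := by
  have hM' : (M : ℝ) ≠ 0 := by positivity
  have hmean : ∑ C : Fin M → X, (∏ w, P (C w)) * ((1 / (M : ℝ)) * ∑ w, cost (C w)) ≤ D := by
    simp_rw [mul_left_comm _ (1 / (M : ℝ))]
    rw [← Finset.mul_sum]
    rw [Finset.sum_congr rfl fun C _ => Finset.mul_sum _ _ _, Finset.sum_comm]
    simp_rw [sum_prod_mul_apply (fun _ => P), hP.2, Finset.prod_const_one, one_mul]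
    simpa [hM'] using hD
  obtain ⟨C, hC⟩ := exists_le_of_sum_stdSimplex_mul_le
    (prod_mem_stdSimplex fun _ : Fin M => hP)
    (f := fun C => √β * ((1 / (M : ℝ)) * ∑ w, cost (C w)) + codebookBound W P τ C)
    (b := √β * D + β) (by
      simp_rw [mul_add, Finset.sum_add_distrib, mul_left_comm _ (√β), ← Finset.mul_sum (a := √β)]
      exact add_le_add (mul_le_mul_of_nonneg_left hmean (Real.sqrt_nonneg β))
        ((sum_codebookBound_le hM hW hP hτ).trans hβ))
  obtain ⟨h, hh⟩ := exists_decoder hM hW P τ C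
  have hsq : 0 < √β := Real.sqrt_pos.mpr hβ0
  have herr0 : 0 ≤ (1 / (M : ℝ)) * ∑ w, ∑ v, W (C w) v * (if h v ≠ w then 1 else 0) :=
    mul_nonneg (by positivity) (Finset.sum_nonneg fun w _ => Finset.sum_nonneg fun v _ =>
      mul_nonneg ((hW _).1 v) (by split_ifs <;> norm_num))
  have hcost0 : 0 ≤ √β * ((1 / (M : ℝ)) * ∑ w, cost (C w)) :=
    mul_nonneg hsq.le (mul_nonneg (by positivity) (Finset.sum_nonneg fun w _ => hcost _))
  refine ⟨C, h, ?_, by linarith⟩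
  rw [← mul_le_mul_iff_right₀ hsq, mul_add, Real.mul_self_sqrt hβ0.le]
  linarith

end oneShot

/-! ### The threshold test over many channel uses -/

theorem outputMix_prod {X V : Type*} [Fintype X] {n : ℕ} (W : X → V → ℝ) (P : X → ℝ) (v : Fin n → V) :
    outputMix (fun (x : Fin n → X) (v : Fin n → V) => ∏ i, W (x i) (v i))
      (fun x => ∏ i, P (x i)) v = ∏ i, outputMix W P (v i) := by
  simp_rw [outputMix, ← Finset.prod_mul_distrib]
  exact (Fintype.prod_sum fun (i : Fin n) x => P x * W x (v i)).symm

section block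

variable {X V : Type*} [Fintype X] [Fintype V] {W : X → V → ℝ} {P : X → ℝ}

/-- The moment generating function, at `-l`, of the information density `log (W(v|x) / q(v))`. -/
noncomputable def infoMoment (W : X → V → ℝ) (P : X → ℝ) (l : ℝ) : ℝ :=
  ∑ x, ∑ v, P x * W x v * (outputMix W P v / W x v) ^ l

theorem infoMoment_nonneg (hW : ∀ x, W x ∈ stdSimplex ℝ V) (hP : P ∈ stdSimplex ℝ X) (l : ℝ) :
    0 ≤ infoMoment W P l :=
  Finset.sum_nonneg fun x _ => Finset.sum_nonneg fun v _ => mul_nonneg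
    (mul_nonneg (hP.1 x) ((hW x).1 v))
    (Real.rpow_nonneg (div_nonneg (outputMix_nonneg hW hP v) ((hW x).1 v)) l)

/-- The Chernoff bound for the information density of a block. -/
theorem missProb_prod_le (hW : ∀ x, W x ∈ stdSimplex ℝ V) (hP : P ∈ stdSimplex ℝ X) (n : ℕ)
    {τ l : ℝ} (hτ : 0 < τ) (hl : 0 ≤ l) :
    missProb (fun (x : Fin n → X) (v : Fin n → V) => ∏ i, W (x i) (v i))
      (fun x => ∏ i, P (x i)) τ ≤ τ ^ l * infoMoment W P l ^ n := by
  have hrhs : infoMoment W P l ^ n = ∑ x : Fin n → X, ∑ v : Fin n → V,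
      ∏ i, (P (x i) * W (x i) (v i) * (outputMix W P (v i) / W (x i) (v i)) ^ l) := by
    have h1 : ∀ x : Fin n → X, ∑ v : Fin n → V,
        ∏ i, (P (x i) * W (x i) (v i) * (outputMix W P (v i) / W (x i) (v i)) ^ l) =
        ∏ i, ∑ v, P (x i) * W (x i) v * (outputMix W P v / W (x i) v) ^ l := fun x =>
      (Fintype.prod_sum fun (i : Fin n) v =>
        P (x i) * W (x i) v * (outputMix W P v / W (x i) v) ^ l).symm
    simp_rw [h1]
    rw [← Fintype.prod_sum fun (_ : Fin n) x =>
      ∑ v, P x * W x v * (outputMix W P v / W x v) ^ l]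
    simp [infoMoment]
  unfold missProb
  simp_rw [hrhs, outputMix_prod, Finset.mul_sum]
  refine Finset.sum_le_sum fun x _ => Finset.sum_le_sum fun v _ => ?_
  have hPx : 0 ≤ ∏ i, P (x i) := Finset.prod_nonneg fun i _ => hP.1 _
  have hWx : ∀ i, 0 ≤ W (x i) (v i) := fun i => (hW _).1 _
  have hq : ∀ i, 0 ≤ outputMix W P (v i) / W (x i) (v i) := fun i =>
    div_nonneg (outputMix_nonneg hW hP _) (hWx i)
  have hr := Finset.prod_nonneg fun i (_ : i ∈ Finset.univ) => hq i
  have key : ((∏ i, W (x i) (v i)) * if ∏ i, W (x i) (v i) < τ * ∏ i, outputMix W P (v i)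
      then 1 else 0) ≤
      (∏ i, W (x i) (v i)) * (τ ^ l * ∏ i, (outputMix W P (v i) / W (x i) (v i)) ^ l) := by
    by_cases h0 : ∏ i, W (x i) (v i) = 0
    · simp [h0]
    have hpos : 0 < ∏ i, W (x i) (v i) :=
      lt_of_le_of_ne (Finset.prod_nonneg fun i _ => hWx i) (Ne.symm h0)
    refine mul_le_mul_of_nonneg_left ?_ hpos.le
    rw [Real.finsetProd_rpow _ _ fun i _ => hq i, ← Real.mul_rpow hτ.le hr]
    split_ifs with h
    · refine Real.one_le_rpow ?_ hl
      rw [Finset.prod_div_distrib, ← mul_div_assoc, one_le_div hpos]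
      exact h.le
    · exact Real.rpow_nonneg (mul_nonneg hτ.le hr) l
  calc _ ≤ _ := mul_le_mul_of_nonneg_left key hPx
    _ = _ := by
      rw [Finset.prod_mul_distrib, Finset.prod_mul_distrib]
      ring

/-- At every rate below the mutual information the Chernoff bound decays exponentially: the
derivative at `l = 0` of `exp (l θ) * infoMoment W P l` is `θ - I`. -/
theorem exists_exp_mul_infoMoment_lt_one (hW : ∀ x, W x ∈ stdSimplex ℝ V)
    (hP : P ∈ stdSimplex ℝ X) {θ : ℝ} (hθ : θ < channelInfo W P) :
    ∃ l, 0 < l ∧ Real.exp (l * θ) * infoMoment W P l < 1 := by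
  have hterm : ∀ x v, HasDerivAt (fun l : ℝ => P x * W x v * (outputMix W P v / W x v) ^ l)
      (-(P x * W x v * Real.log (W x v / outputMix W P v))) 0 := by
    intro x v
    by_cases h0 : P x * W x v = 0
    · simpa [h0] using hasDerivAt_const (0 : ℝ) (0 : ℝ)
    have hpos : 0 < P x * W x v := lt_of_le_of_ne (mul_nonneg (hP.1 x) ((hW x).1 v)) (Ne.symm h0)
    have hWpos : 0 < W x v := lt_of_le_of_ne ((hW x).1 v) (right_ne_zero_of_mul h0).symm
    have hb : 0 < outputMix W P v / W x v :=
      div_pos (hpos.trans_le (mul_le_outputMix hW hP x v)) hWpos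
    have h := ((hasDerivAt_id (0 : ℝ)).const_rpow hb).const_mul (P x * W x v)
    simp only [id, Real.rpow_zero, mul_one] at h
    have hlog : Real.log (outputMix W P v / W x v) = -Real.log (W x v / outputMix W P v) := by
      rw [← Real.log_inv, inv_div]
    rwa [hlog, mul_neg] at h
  have hI : HasDerivAt (infoMoment W P) (-channelInfo W P) 0 := by
    have h := HasDerivAt.fun_sum fun x (_ : x ∈ Finset.univ) =>
      HasDerivAt.fun_sum fun v (_ : v ∈ Finset.univ) => hterm x v
    simp only [Finset.sum_neg_distrib] at h
    exact h
  have h0 : infoMoment W P 0 = 1 := by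
    simp_rw [infoMoment, Real.rpow_zero, mul_one, ← Finset.mul_sum, (hW _).2, mul_one, hP.2]
  have hexp : HasDerivAt (fun l : ℝ => Real.exp (l * θ)) θ 0 := by
    simpa using ((hasDerivAt_id (0 : ℝ)).mul_const θ).exp
  have hf := hexp.mul hI
  rw [hasDerivAt_iff_tendsto_slope_zero] at hf
  simp only [Pi.mul_apply, zero_mul, Real.exp_zero, h0, mul_one, one_mul, zero_add,
    smul_eq_mul] at hf
  have hev := (hf.mono_left (nhdsWithin_mono 0 fun t (ht : t ∈ Set.Ioi (0 : ℝ)) =>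
    ne_of_gt ht)).eventually (eventually_lt_nhds (show θ + -channelInfo W P < 0 by linarith))
  obtain ⟨l, hl, hlpos⟩ := (hev.and self_mem_nhdsWithin).exists
  refine ⟨l, hlpos, ?_⟩
  have := neg_of_mul_neg_right hl (inv_nonneg.mpr (le_of_lt hlpos))
  linarith

end block

namespace ISACModel

variable {X S ST SR Y Z Shat : Type*} [Fintype X] [Fintype S] [Fintype ST] [Fintype SR]
  [Fintype Y] [Fintype Z] [Fintype Shat]

/-! ### Achievability -/

/-- The code that sends the codewords of a fixed codebook, ignoring the feedback, and estimates
the sensing states symbol by symbol. -/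
noncomputable def codebookCode [Nonempty Shat] (m : ISACModel X S ST SR Y Z Shat) {M n : ℕ}
    (C : Fin M → Fin n → X) (h : (Fin n → Y × SR) → Fin M) : ISACCode X SR Y Z Shat M n where
  encoder w i _ := C w i
  decoder y r := h fun i => (y i, r i)
  estimator x z i := m.bestEstimate (x i) (z i)

section codebook

variable [Nonempty Shat] (m : ISACModel X S ST SR Y Z Shat) {M n : ℕ} (C : Fin M → Fin n → X)
  (h : (Fin n → Y × SR) → Fin M)

open Classical in
theorem errorProb_codebookCode : m.errorProb (m.codebookCode C h) =
    (1 / (M : ℝ)) * ∑ w, ∑ v : Fin n → Y × SR,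
      (∏ i, m.receiverChannel (C w i) (v i)) * (if h v ≠ w then 1 else 0) := by
  rw [errorProb_eq, codeMean]
  congr 1
  refine Finset.sum_congr rfl fun w _ => ?_
  have h1 := sum_prod_mul_comp (fun i a => m.letterLaw (C w i) a) observed
    fun v => if h v ≠ w then (1 : ℝ) else 0
  simp_rw [sum_letterLaw_fiber] at h1
  rw [← h1]
  rfl

theorem blockDistortion_codebookCode : m.blockDistortion (m.codebookCode C h) =
    (1 / (M : ℝ)) * ∑ w, (1 / (n : ℝ)) * ∑ i, m.sensingCost (C w i) := by
  rw [blockDistortion_eq, ← Finset.mul_sum, mul_left_comm]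
  congr 1
  simp_rw [codeMean]
  rw [← Finset.mul_sum, Finset.sum_comm]
  congr 1
  refine Finset.sum_congr rfl fun w _ => Finset.sum_congr rfl fun i _ => ?_
  have h1 := sum_prod_mul_apply (fun i a => m.letterLaw (C w i) a) i
    fun a => m.dist a.1.2.1 (m.bestEstimate (C w i) a.2.2)
  simp_rw [sum_letterLaw, Finset.prod_const_one, one_mul,
    sum_letterLaw_mul_dist_bestEstimate] at h1
  exact h1

end codebook

theorem limsup_le_of_le_add {u e : ℕ → ℝ} {D : ℝ} (hu : ∀ n, 0 ≤ u n)
    (h : ∀ n, u n ≤ D + e n) (he : Tendsto e atTop (𝓝 0)) : limsup u atTop ≤ D := by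
  have hlim : Tendsto (fun n => D + e n) atTop (𝓝 D) := by simpa using he.const_add D
  rw [← hlim.limsup_eq]
  exact limsup_le_limsup (.of_forall h)
    (isBoundedUnder_of ⟨0, hu⟩ : IsBoundedUnder (· ≥ ·) atTop u).isCoboundedUnder_le
    hlim.isBoundedUnder_le

/-- If an input law is feasible, some letter is, and repeating it senses well enough. -/
theorem achievable_zero [Nonempty Shat] (m : ISACModel X S ST SR Y Z Shat) {D : ℝ} {P : X → ℝ}
    (hP : P ∈ m.feasibleInputs D) : m.Achievable 0 D := by
  rw [mem_feasibleInputs_iff] at hP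
  obtain ⟨x, hx⟩ := exists_le_of_sum_stdSimplex_mul_le hP.1 hP.2
  have hM : ∀ n : ℕ, ⌊(2 : ℝ) ^ ((n : ℝ) * 0)⌋₊ = 1 := by simp
  refine ⟨le_rfl, fun n => m.codebookCode (fun _ _ => x) fun _ => ⟨0, by simp⟩, ?_, ?_⟩
  · have hz : ∀ n : ℕ, m.errorProb (m.codebookCode (n := n) (fun _ _ => x)
        fun _ => (⟨0, by simp⟩ : Fin ⌊(2 : ℝ) ^ ((n : ℝ) * 0)⌋₊)) = 0 := by
      intro n
      rw [errorProb_codebookCode]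
      have : Subsingleton (Fin ⌊(2 : ℝ) ^ ((n : ℝ) * 0)⌋₊) := by
        rw [hM n]
        infer_instance
      simp [eq_iff_true_of_subsingleton]
    simp_rw [hz]
    exact tendsto_const_nhds
  · refine limsup_le_of_le_add (e := fun _ => 0) (fun n => m.blockDistortion_nonneg _)
      (fun n => ?_) tendsto_const_nhds
    have hD : 0 ≤ D := (m.sensingCost_nonneg x).trans hx
    rw [blockDistortion_codebookCode, add_zero]
    simp only [hM, Finset.sum_const, Finset.card_univ, Fintype.card_fin, nsmul_eq_mul,
      Nat.cast_one, div_one, one_mul]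
    rw [← mul_assoc, one_div]
    exact (mul_le_of_le_one_left (m.sensingCost_nonneg x) inv_mul_le_one).trans hx

/-- Every rate below the mutual information of a feasible input law is achievable. -/
theorem achievable_of_lt_mutualInfo [Nonempty Shat] (m : ISACModel X S ST SR Y Z Shat) {R D : ℝ}
    {P : X → ℝ} (hP : P ∈ m.feasibleInputs D) (hR : 0 ≤ R) (hlt : R < m.mutualInfo P) :
    m.Achievable R D := by
  rw [mem_feasibleInputs_iff] at hP
  obtain ⟨hP, hD⟩ := hP
  have hW := m.receiverChannel_mem
  rw [m.mutualInfo_eq hP, lt_div_iff₀ (Real.log_pos one_lt_two)] at hlt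
  -- Threshold exponent `θ` strictly between the rate and the mutual information, in nats.
  obtain ⟨θ, hRθ, hθ⟩ := exists_between hlt
  obtain ⟨l, hl, hρ⟩ := exists_exp_mul_infoMoment_lt_one hW hP hθ
  have hD0 : 0 ≤ D := (Finset.sum_nonneg fun x _ =>
    mul_nonneg (hP.1 x) (m.sensingCost_nonneg x)).trans hD
  set ρ := Real.exp (l * θ) * infoMoment m.receiverChannel P l with hρdef
  have hρ0 : 0 ≤ ρ := mul_nonneg (Real.exp_pos _).le (infoMoment_nonneg hW hP l)
  let η := Real.exp (R * Real.log 2 - θ)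
  have hη : η < 1 := Real.exp_zero ▸ Real.exp_lt_exp.mpr (by linarith)
  let β : ℕ → ℝ := fun n => ρ ^ n + η ^ n
  have hβ0 : ∀ n, 0 < β n := fun n => add_pos_of_nonneg_of_pos (by positivity) (by positivity)
  have hβ : Tendsto β atTop (𝓝 0) := by
    simpa using (tendsto_pow_atTop_nhds_zero_of_lt_one hρ0 hρ).add
      (tendsto_pow_atTop_nhds_zero_of_lt_one (Real.exp_pos _).le hη)
  have hsq : Tendsto (fun n => √(β n)) atTop (𝓝 0) := by
    simpa using hβ.sqrt
  have hcode : ∀ n : ℕ, ∃ c : ISACCode X SR Y Z Shat ⌊(2 : ℝ) ^ ((n : ℝ) * R)⌋₊ n,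
      m.blockDistortion c ≤ D + √(β n) ∧ m.errorProb c ≤ √(β n) * D + β n := by
    intro n
    have hmiss := missProb_prod_le hW hP n (Real.exp_pos (n * θ)) hl.le
    have hM : (⌊(2 : ℝ) ^ ((n : ℝ) * R)⌋₊ : ℝ) / Real.exp (n * θ) ≤ η ^ n := by
      rw [div_le_iff₀ (Real.exp_pos _), ← Real.exp_nat_mul, ← Real.exp_add]
      refine (Nat.floor_le (by positivity)).trans_eq ?_
      rw [Real.rpow_def_of_pos two_pos]
      congr 1
      ring
    have hρn : Real.exp (n * θ) ^ l * infoMoment m.receiverChannel P l ^ n = ρ ^ n := by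
      rw [hρdef, mul_pow, ← Real.exp_mul, ← Real.exp_nat_mul]
      congr 2
      ring
    rw [hρn] at hmiss
    have hcost : ∑ x : Fin n → X, (∏ i, P (x i)) * ((1 / (n : ℝ)) * ∑ i, m.sensingCost (x i)) ≤
        D := by
      simp_rw [mul_left_comm _ (1 / (n : ℝ))]
      rw [← Finset.mul_sum, Finset.sum_congr rfl fun x _ => Finset.mul_sum _ _ _,
        Finset.sum_comm]
      simp_rw [sum_prod_mul_apply (fun _ : Fin n => P), hP.2, Finset.prod_const_one, one_mul]
      rw [Finset.sum_const, Finset.card_univ, Fintype.card_fin, nsmul_eq_mul, ← mul_assoc,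
        one_div]
      exact (mul_le_of_le_one_left (Finset.sum_nonneg fun x _ =>
        mul_nonneg (hP.1 x) (m.sensingCost_nonneg x)) inv_mul_le_one).trans hD
    obtain ⟨C, h, h1, h2⟩ := exists_codebook (messageCount_pos hR n)
      (W := fun (x : Fin n → X) (v : Fin n → Y × SR) => ∏ i, m.receiverChannel (x i) (v i))
      (P := fun x : Fin n → X => ∏ i, P (x i))
      (cost := fun x : Fin n → X => (1 / (n : ℝ)) * ∑ i, m.sensingCost (x i))
      (fun x => prod_mem_stdSimplex fun i => hW (x i)) (prod_mem_stdSimplex fun _ : Fin n => hP)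
      (Real.exp_pos (n * θ)) (fun x => mul_nonneg (by positivity)
        (Finset.sum_nonneg fun i _ => m.sensingCost_nonneg (x i))) hcost
      (add_le_add hmiss hM) (hβ0 n)
    refine ⟨m.codebookCode C h, ?_, ?_⟩
    · rw [blockDistortion_codebookCode]
      exact h1
    · rw [errorProb_codebookCode]
      exact h2
  choose c hc1 hc2 using hcode
  refine ⟨hR, c, ?_, limsup_le_of_le_add (fun n => m.blockDistortion_nonneg _) hc1 hsq⟩
  refine squeeze_zero (fun n => ?_) hc2 (by simpa using (hsq.mul_const D).add hβ)
  rw [errorProb_eq]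
  exact m.codeMean_nonneg _ fun w a => by split_ifs <;> norm_num

/-! ### The capacity-distortion function -/

theorem nonempty_of_mem_stdSimplex {ι : Type*} [Fintype ι] {μ : ι → ℝ}
    (hμ : μ ∈ stdSimplex ℝ ι) : Nonempty ι := by
  by_contra h
  rw [not_nonempty_iff] at h
  simpa using hμ.2

theorem nonempty_feedback (m : ISACModel X S ST SR Y Z Shat) (x : X) : Nonempty Z :=
  let ⟨s⟩ := nonempty_of_mem_stdSimplex m.stateLaw_mem
  (nonempty_of_mem_stdSimplex (m.channel_mem x s.1)).map Prod.snd

theorem nonempty_estimate_of_feasible {m : ISACModel X S ST SR Y Z Shat} {D : ℝ} {P : X → ℝ}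
    (hP : P ∈ m.feasibleInputs D) : Nonempty Shat := by
  obtain ⟨hP, q, hq, -⟩ := hP
  obtain ⟨x⟩ := nonempty_of_mem_stdSimplex hP
  obtain ⟨z⟩ := m.nonempty_feedback x
  exact nonempty_of_mem_stdSimplex (hq x z)

/-- A code of block length one contains an input letter, and an estimate for it. -/
theorem Achievable.nonempty_estimate {m : ISACModel X S ST SR Y Z Shat} {R D : ℝ}
    (h : m.Achievable R D) : Nonempty Shat := by
  obtain ⟨hR, c, -⟩ := h
  have x : X := (c 1).encoder ⟨0, messageCount_pos hR 1⟩ 0 fun j => j.elim0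
  obtain ⟨z⟩ := m.nonempty_feedback x
  exact ⟨(c 1).estimator (fun _ => x) (fun _ => z) 0⟩

theorem isCompact_feasibleInputs [Nonempty Shat] (m : ISACModel X S ST SR Y Z Shat) (D : ℝ) :
    IsCompact (m.feasibleInputs D) := by
  have h : m.feasibleInputs D = stdSimplex ℝ X ∩ {P | ∑ x, P x * m.sensingCost x ≤ D} :=
    Set.ext fun P => m.mem_feasibleInputs_iff
  rw [h]
  exact (isCompact_stdSimplex ℝ X).inter_right (isClosed_le (by fun_prop) continuous_const)

theorem continuousOn_mutualInfo (m : ISACModel X S ST SR Y Z Shat) :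
    ContinuousOn m.mutualInfo (stdSimplex ℝ X) :=
  ((continuousOn_channelInfo m.receiverChannel_mem).div_const _).congr
    fun _ hP => m.mutualInfo_eq hP

end ISACModel

theorem theorem1 {X S ST SR Y Z Shat : Type*} [Fintype X] [Fintype S] [Fintype ST] [Fintype SR]
    [Fintype Y] [Fintype Z] [Fintype Shat] (m : ISACModel X S ST SR Y Z Shat) (D : ℝ) :
    ((∃ R, m.Achievable R D) ↔ (m.feasibleInputs D).Nonempty) ∧
      ((m.feasibleInputs D).Nonempty →
        IsLUB {R | m.Achievable R D} (m.capacityDistortion D) ∧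
          IsGreatest (m.mutualInfo '' m.feasibleInputs D) (m.capacityDistortion D)) := by
  refine ⟨⟨?_, ?_⟩, ?_⟩
  · rintro ⟨R, hR⟩
    have := hR.nonempty_estimate
    obtain ⟨P, hP, -⟩ := hR.exists_mem_feasibleInputs
    exact ⟨P, hP⟩
  · rintro ⟨P, hP⟩
    have := ISACModel.nonempty_estimate_of_feasible hP
    exact ⟨0, m.achievable_zero hP⟩
  · rintro ⟨P₀, hP₀⟩
    have := ISACModel.nonempty_estimate_of_feasible hP₀
    obtain ⟨P, hP, hmax⟩ := (m.isCompact_feasibleInputs D).exists_isMaxOn ⟨P₀, hP₀⟩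
      (m.continuousOn_mutualInfo.mono fun P hP => hP.1)
    have hlub : IsLUB {R | m.Achievable R D} (m.mutualInfo P) := by
      refine ⟨fun R hR => ?_, fun b hb => ?_⟩
      · obtain ⟨P', hP', hle⟩ := ISACModel.Achievable.exists_mem_feasibleInputs hR
        exact hle.trans (hmax hP')
      · refine le_of_forall_lt_imp_le_of_dense fun R hR => ?_
        rcases le_total 0 R with h | h
        · exact hb (m.achievable_of_lt_mutualInfo hP h hR)
        · exact h.trans (hb (m.achievable_zero hP))
    have hC : m.capacityDistortion D = m.mutualInfo P :=
      hlub.csSup_eq ⟨0, m.achievable_zero hP⟩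
    rw [hC]
    exact ⟨hlub, ⟨P, hP, rfl⟩, Set.forall_mem_image.mpr fun P' hP' => hmax hP'⟩
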